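/- **Definitions.** A *semi-graph* $S$ consists of a finite set $V$ of nodes, a finite set $E$ of edges and an incidence relation between nodes and edges in which every edge is incident to at most two nodes. A *half-edge* is an incident pair $(v,e)$; $\deg(v)$ is the number of edges incident to $v$ and $\operatorname{rank}(e)\in\{0,1,2\}$ is the number of nodes incident to $e$. The *underlying graph* of $S$ is the simple graph on $V$ in which two distinct nodes are adjacent iff they share an edge; $\Delta$ denotes its maximum degree. Every simple graph is a semi-graph in which all edges have rank $2$. A *node-edge-checkable problem* $\Pi=(\Sigma,\mathcal N,\mathcal E)$ consists of a (possibly infinite) label set $\Sigma$, for each $i\ge 0$ a collection $\mathcal N^i$ of multisets of cardinality $i$ over $\Sigma$, and for each $i\in\{0,1,2\}$ a collection $\mathcal E^i$ of multisets of cardinality $i$ over $\Sigma$. A *valid solution* of $\Pi$ on $S$ is a labeling of the half-edges of $S$ by elements of $\Sigma$ such that for every node $v$ the multiset of labels on its half-edges is in $\mathcal N^{\deg(v)}$, and for every edge $e$ the multiset of labels on its half-edges is in $\mathcal E^{\operatorname{rank}(e)}$. For $\psi\in\mathcal E^j$ and $i+j\le 2$ let $\mathcal E^i_\psi$ be the collection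 of multisets $\chi$ of cardinality $i$ over $\Sigma$ with $\chi+\psi\in\mathcal E^{i+j}$ (where $+$ is the sum of multisets). An input instance of the *edge-list variant* $\Pi^\times$ is a semi-graph $S$ together with an assignment to each edge $e$ of a collection $h_{\mathrm{in}}(e)$ of the form $\mathcal E^{\operatorname{rank}(e)}_\psi$ with $\psi\in\mathcal E^j$ for some $0\le j\le 2-\operatorname{rank}(e)$. A valid solution of this instance is a labeling of the half-edges by elements of $\Sigma$ such that for every node $v$ the multiset of labels at $v$ is in $\mathcal N^{\deg(v)}$, and for every edge $e$ the multiset of labels at $e$ is in $h_{\mathrm{in}}(e)$. Algorithms are deterministic algorithms in the LOCAL model: the nodes know the number $n$ of nodes and $\Delta$, have unique identifiers from $\{1,\dots,n^c\}$ for a fixed integer constant $c\ge 1$, number their half-edges by ports, know the ranks of their incident edges, communicate in synchronous rounds with unbounded messages along edges of rank $2$, and have unbounded computational power; equivalently, in a $T$-round algorithm every node chooses the labels of its half-edges as a function of $n$, $\Delta$ and its $T$-hop neighbourhood. $\log^* n$ is the number of times $\log_2$ has to be applied to $n$ until the result is at most $1$. **Theorem.** Let $\Pi$ be a node-edge-checkable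 problem and let $f:[0,\infty)\to[0,\infty)$ be continuous and monotonically non-decreasing with $f(0)=0$ and $f(x)>0$ for some $x>0$. Assume that * there is an algorithm that solves $\Pi$ on all semi-graphs within $O(f(\Delta)+\log^* n)$ rounds, and * $\Pi^\times$ has a valid solution on every input instance. Let $g$ be a function that assigns to every integer $n\ge 1$ a nonnegative real $g(n)$ with $g(n)^{f(g(n))}=n$. Then there is an algorithm that solves $\Pi$ on all trees within $O(f(g(n))+\log^* n)$ rounds. -/

import Mathlib

open scoped NNReal

/-- A semi-graph with node set `V` and edge set `E`, given by its incidence relation: every edge is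
incident to at most two nodes. Parallel edges and edges with one or no endpoint are allowed. -/
structure SemiGraph (V E : Type) where
  Inc : V → E → Prop
  rank_le_two : ∀ e, {v | Inc v e}.encard ≤ 2

namespace SemiGraph

variable {V E : Type} (S : SemiGraph V E)

/-- The half-edges: incident pairs of a node and an edge. -/
abbrev HalfEdge : Type := {h : V × E // S.Inc h.1 h.2}

/-- The degree of a node: the number of its incident edges (of any rank). -/
noncomputable def degree (v : V) : ℕ := {e | S.Inc v e}.ncard

/-- The rank of an edge: the number of its endpoints. -/
noncomputable def rank (e : E) : ℕ := {v | S.Inc v e}.ncard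

/-- The underlying simple graph: two distinct nodes are adjacent if they share an edge. -/
def underlying : SimpleGraph V where
  Adj u v := u ≠ v ∧ ∃ e, S.Inc u e ∧ S.Inc v e
  symm := ⟨fun _ _ h => ⟨h.1.symm, h.2.imp fun _ he => ⟨he.2, he.1⟩⟩⟩
  loopless := ⟨fun _ h => h.1 rfl⟩

/-- The underlying degree `Δ`: the maximum degree of the underlying graph of a finite semi-graph
(`0` if there are no nodes). -/
noncomputable def maxDegree : ℕ := ⨆ v, (S.underlying.neighborSet v).ncard

/-- The multiset of labels that a half-edge labeling puts on the half-edges at the node `v`. -/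
noncomputable def nodeLabels [Finite V] [Finite E] {L : Type*} (h : S.HalfEdge → L) (v : V) :
    Multiset L :=
  (Set.toFinite {x : S.HalfEdge | x.1.1 = v}).toFinset.val.map h

/-- The multiset of labels that a half-edge labeling puts on the half-edges at the edge `e`. -/
noncomputable def edgeLabels [Finite V] [Finite E] {L : Type*} (h : S.HalfEdge → L) (e : E) :
    Multiset L :=
  (Set.toFinite {x : S.HalfEdge | x.1.2 = e}).toFinset.val.map h

/-- A simple graph regarded as a semi-graph. -/
def ofGraph (G : SimpleGraph V) : SemiGraph V G.edgeSet where
  Inc v e := v ∈ (e : Sym2 V)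
  rank_le_two := by
    rintro ⟨e, he⟩
    induction e using Sym2.ind with
    | _ a b =>
      have h : {v | v ∈ s(a, b)} = ({a, b} : Set V) := by
        ext v
        simp
      change {v | v ∈ s(a, b)}.encard ≤ 2
      rw [h]
      refine (Set.encard_insert_le _ _).trans ?_
      rw [Set.encard_singleton]
      norm_num

end SemiGraph

/-- A node-edge-checkable problem with label set `L`: collections `node i` of multisets of
cardinality `i` for all `i`, and collections `edge i` of multisets of cardinality `i` for
`i = 0, 1, 2` (`edge i` is empty for larger `i`). -/
structure NodeEdgeProblem (L : Type*) where
  node : ℕ → Set (Multiset L)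
  edge : ℕ → Set (Multiset L)
  card_node : ∀ i, ∀ m ∈ node i, m.card = i
  card_edge : ∀ i, ∀ m ∈ edge i, m.card = i ∧ i ≤ 2

namespace NodeEdgeProblem

variable {L : Type*} (P : NodeEdgeProblem L)

/-- The half-edge labeling `h` is a valid solution of the problem `P` on `S`. -/
def IsSolution {V E : Type} [Finite V] [Finite E] (S : SemiGraph V E) (h : S.HalfEdge → L) : Prop :=
  (∀ v, S.nodeLabels h v ∈ P.node (S.degree v)) ∧ ∀ e, S.edgeLabels h e ∈ P.edge (S.rank e)

/-- The label multisets of cardinality `i` that complete `ψ` to an allowed edge configuration. -/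
def edgeResidual (i : ℕ) (ψ : Multiset L) : Set (Multiset L) :=
  {χ | χ.card = i ∧ χ + ψ ∈ P.edge (i + ψ.card)}

/-- The possible input lists of an edge of rank `i` in the edge-list variant of `P`. -/
def edgeLists (i : ℕ) : Set (Set (Multiset L)) :=
  {K | ∃ j, i + j ≤ 2 ∧ ∃ ψ ∈ P.edge j, K = P.edgeResidual i ψ}

/-- `(S, hin)` is an input instance of the edge-list variant of `P`. -/
def IsEdgeListInstance {V E : Type} (S : SemiGraph V E) (hin : E → Set (Multiset L)) : Prop :=
  ∀ e, hin e ∈ P.edgeLists (S.rank e)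

/-- `h` is a valid solution of the edge-list variant of `P` on the input instance `(S, hin)`. -/
def IsEdgeListSolution {V E : Type} [Finite V] [Finite E] (S : SemiGraph V E)
    (hin : E → Set (Multiset L)) (h : S.HalfEdge → L) : Prop :=
  (∀ v, S.nodeLabels h v ∈ P.node (S.degree v)) ∧ ∀ e, S.edgeLabels h e ∈ hin e

/-- The edge-list variant of `P` has a valid solution on every (finite) input instance. -/
def EdgeListAlwaysSolvable : Prop :=
  ∀ (V E : Type) [Finite V] [Finite E] (S : SemiGraph V E) (hin : E → Set (Multiset L)),
    P.IsEdgeListInstance S hin → ∃ h : S.HalfEdge → L, P.IsEdgeListSolution S hin h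

end NodeEdgeProblem

/-- The symmetry-breaking data of the LOCAL model on a semi-graph with `n` nodes: globally unique
identifiers from `{1, …, n ^ c}`, and at every node `v` a numbering of the incident half-edges by
the ports `0, …, deg v - 1`. Values of `port v e` for `e` not incident to `v` are never used. -/
structure LocalInput {V E : Type} (S : SemiGraph V E) (c : ℕ) where
  ident : V → ℕ
  ident_injective : Function.Injective ident
  ident_mem : ∀ v, ident v ∈ Set.Icc 1 (Nat.card V ^ c)
  port : V → E → ℕ
  port_bijOn : ∀ v, Set.BijOn (port v) {e | S.Inc v e} (Set.Iio (S.degree v))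

/-- What a node can know about the network after some number of rounds, as sets of facts:
its own identifier, pairs (identifier, degree) of nodes, triples (identifier of a node, port,
rank of the edge at that port), and quadruples (identifier of `u`, port at `u`, identifier of `w`,
port at `w`) for edges between distinct nodes `u` and `w`. -/
@[ext]
structure LocalView where
  self : ℕ
  nodes : Set (ℕ × ℕ)
  ends : Set (ℕ × ℕ × ℕ)
  links : Set (ℕ × ℕ × ℕ × ℕ)

/-- The `T`-hop neighbourhood of `v`, i.e. everything that `v` can learn in `T` rounds of sending
messages along the edges of rank `2`: the initial knowledge (identifier, degree, ranks of the
incident edges) of all nodes at distance at most `T` and, for all nodes at distance less than `T`,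
how their ports are connected. -/
def LocalInput.view {V E : Type} {S : SemiGraph V E} {c : ℕ} (I : LocalInput S c) (T : ℕ) (v : V) :
    LocalView where
  self := I.ident v
  nodes := {x | ∃ u, S.underlying.edist v u ≤ T ∧ x = (I.ident u, S.degree u)}
  ends := {x | ∃ u e, S.underlying.edist v u ≤ T ∧ S.Inc u e ∧
    x = (I.ident u, I.port u e, S.rank e)}
  links := {x | ∃ u w e, S.underlying.edist v u < T ∧ u ≠ w ∧ S.Inc u e ∧ S.Inc w e ∧
    x = (I.ident u, I.port u e, I.ident w, I.port w e)}

/-- A deterministic LOCAL algorithm: all nodes know the number of nodes `n` and the underlying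
degree `Δ`; after `rounds n Δ` rounds every node chooses, as an arbitrary function of `n`, `Δ` and
its `rounds n Δ`-hop neighbourhood, an output label for each of its ports. -/
structure LocalAlgorithm (L : Type*) where
  rounds : ℕ → ℕ → ℕ
  out : ℕ → ℕ → LocalView → ℕ → L

/-- The half-edge labeling that the algorithm outputs on a semi-graph. -/
noncomputable def LocalAlgorithm.run {L : Type*} (A : LocalAlgorithm L) {V E : Type}
    {S : SemiGraph V E} {c : ℕ} (I : LocalInput S c) (h : S.HalfEdge) : L :=
  A.out (Nat.card V) S.maxDegree
    (I.view (A.rounds (Nat.card V) S.maxDegree) h.1.1) (I.port h.1.1 h.1.2)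

/-- The iterated logarithm `log* x`: how often `log₂` has to be applied to `x` until the result is
at most `1`. -/
noncomputable def logStar (x : ℝ) : ℕ := sInf {k : ℕ | (Real.logb 2)^[k] x ≤ 1}

namespace NodeEdgeProblem

variable {L : Type*} (P : NodeEdgeProblem L)

/-- With identifiers from `{1, …, n ^ c}`, some LOCAL algorithm solves `P` on all (finite)
semi-graphs within `O(R n Δ)` rounds, where `Δ` is the underlying degree. -/
def SolvableOnSemiGraphs (c : ℕ) (R : ℕ → ℕ → ℝ) : Prop :=
  ∃ A : LocalAlgorithm L,
    (∃ C : ℝ, ∀ n Δ, (A.rounds n Δ : ℝ) ≤ C * R n Δ) ∧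
    ∀ (V E : Type) [Finite V] [Finite E] (S : SemiGraph V E) (I : LocalInput S c),
      P.IsSolution S (A.run I)

/-- With identifiers from `{1, …, n ^ c}`, some LOCAL algorithm solves `P` on all (finite) trees
within `O(R n)` rounds. -/
def SolvableOnTrees (c : ℕ) (R : ℕ → ℝ) : Prop :=
  ∃ A : LocalAlgorithm L,
    (∃ C : ℝ, ∀ n Δ, (A.rounds n Δ : ℝ) ≤ C * R n) ∧
    ∀ (V : Type) [Finite V] (G : SimpleGraph V), G.IsTree →
      ∀ I : LocalInput (SemiGraph.ofGraph G) c,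
        P.IsSolution (SemiGraph.ofGraph G) (A.run I)

end NodeEdgeProblem

/-! Rake and compress with a degree threshold `k` splits the tree into a part of low degree and a
part whose components have small diameter. Each iteration compresses the vertices that have degree
at most `k` in the remaining graph, as do all their neighbours, and then rakes the vertices of
degree at most 1. Counting edges in a forest shows that an iteration keeps at most a fraction `6 /
(k + 1)` of the vertices, so for `k ≥ 36` nothing remains after `l = log_k (n ^ 2) + 1` iterations
(`IsAcyclic.peel_eq_empty`). The compressed vertices span a graph of degree at most `k`
(`degreeIn_compressed_le`), and the components of the raked ones have diameter at most `2 l`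
(`exists_walk_length_le_of_peel_eq_empty`).

The given algorithm runs on the semi-graph formed by the half-edges at compressed vertices, where
edges towards raked vertices merely lose rank. This costs `O(f k + log* n)` rounds
(`view_restrictNodes`, `isSolution_restrictNodes`). Its labels turn the rest into an instance of the
edge-list variant, so a completion exists (`exists_completion`). Every raked vertex sees its whole
component and chooses a completion there by a fixed rule; vertices of one component see the same
data, hence choose consistently (`exists_isLocal_completion`).

With `k` essentially `g n`, the equation `g n ^ f (g n) = n` gives `log_k n = O(f (g n) + 1)`, which
balances the decomposition against the simulation. -/

/-! ### Rake and compress in forests -/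

namespace SimpleGraph

variable {V : Type*} (G : SimpleGraph V)

/-- The number of neighbours of `v` in the set `A`. -/
noncomputable def degreeIn (A : Set V) (v : V) : ℕ := {w | G.Adj v w ∧ w ∈ A}.ncard

/-- In a forest, the degrees inside a vertex set `X` sum up to at most `2 |X|`. -/
theorem IsAcyclic.sum_degreeIn_le [Fintype V] (hG : G.IsAcyclic) (X : Finset V) :
    ∑ v ∈ X, G.degreeIn X v ≤ 2 * X.card := by
  classical
  rcases X.eq_empty_or_nonempty with rfl | hne
  · simp
  have hX : Nonempty X := hne.to_subtype
  let H := G.induce (X : Set V)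
  have hH : H.IsAcyclic := hG.induce _
  -- The induced forest extends to a spanning tree of the complete graph on `X`, so it has fewer
  -- than `|X|` edges.
  obtain ⟨T, hHT, -, hT⟩ := (connected_top (V := (X : Set V))).exists_isTree_le_of_le_of_isAcyclic
    (H := H) le_top hH
  have h1 : H.edgeFinset.card ≤ T.edgeFinset.card := Finset.card_le_card (by simpa using hHT)
  have h2 := hT.card_edgeFinset
  have h3 := H.sum_degrees_eq_twice_card_edges
  have h4 : ∑ v ∈ X, G.degreeIn X v = ∑ v : (X : Set V), H.degree v := by
    rw [← Finset.sum_coe_sort X]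
    refine Finset.sum_congr rfl fun v _ => ?_
    rw [← card_neighborFinset_eq_degree, ← Set.ncard_coe_finset,
      ← Set.ncard_image_of_injective _ Subtype.val_injective]
    unfold degreeIn
    congr 1
    ext w
    simp [H]
  have h5 : Fintype.card (X : Set V) = X.card := by simp
  omega

variable (k : ℕ)

/-- The vertices of `A` such that they and all their neighbours in `A` have degree at most `k`
inside `A`. -/
def compress (A : Set V) : Set V :=
  {v | v ∈ A ∧ G.degreeIn A v ≤ k ∧ ∀ w, G.Adj v w → w ∈ A → G.degreeIn A w ≤ k}

/-- The vertices of degree at most `1` that remain in `A` after compressing. -/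
def rake (A : Set V) : Set V :=
  {v | v ∈ A ∧ v ∉ G.compress k A ∧ G.degreeIn (A \ G.compress k A) v ≤ 1}

/-- The vertices that remain after some iterations of compressing and raking. -/
def peel : ℕ → Set V
  | 0 => Set.univ
  | i + 1 => {v | v ∈ peel i ∧ v ∉ G.compress k (peel i) ∧ v ∉ G.rake k (peel i)}

theorem peel_succ_subset (i : ℕ) : G.peel k (i + 1) ⊆ G.peel k i := fun _ h => h.1

theorem peel_antitone : Antitone (G.peel k) := antitone_nat_of_succ_le (G.peel_succ_subset k)

/-- Let `H` be the vertices of degree above `k` in `A`, and `W` the other survivors; the degree sum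
gives `(k + 1) |H| ≤ 2 |A|`. Each vertex of `W` has a neighbour in `H`, as it was not compressed,
and two neighbours in `B`, as it was not raked. These lie in `H ∪ W`: a raked neighbour outside `H`
would itself have two neighbours in `B`, namely the given vertex and one in `H`. So the degree sum
in `H ∪ W` is at least `2 |W| + |W|` and at most `2 (|H| + |W|)`, whence `|W| ≤ 2 |H|`. -/
theorem IsAcyclic.ncard_peel_succ_le [Finite V] (hG : G.IsAcyclic) (i : ℕ) :
    (k + 1) * (G.peel k (i + 1)).ncard ≤ 6 * (G.peel k i).ncard := by
  classical
  have := Fintype.ofFinite V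
  set A := G.peel k i with hA
  let B := A \ G.compress k A
  let AF : Finset V := Set.toFinset A
  let H : Finset V := AF.filter fun v => k < G.degreeIn A v
  let W : Finset V := AF.filter fun v =>
    v ∉ H ∧ v ∉ G.compress k A ∧ v ∉ G.rake k A
  have hAF : (AF : Set V) = A := Set.coe_toFinset A
  have hH : (k + 1) * H.card ≤ 2 * AF.card := by
    refine le_trans ?_ (hG.sum_degreeIn_le G AF)
    calc (k + 1) * H.card = ∑ v ∈ H, (k + 1) := by simp [mul_comm]
      _ ≤ ∑ v ∈ H, G.degreeIn AF v := Finset.sum_le_sum fun v hv => by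
          rw [hAF]; exact (Finset.mem_filter.mp hv).2
      _ ≤ _ := Finset.sum_le_sum_of_subset (Finset.filter_subset _ _)
  have memA : ∀ v, v ∈ AF ↔ v ∈ A := fun v => Set.mem_toFinset
  have memH : ∀ v, v ∈ H ↔ v ∈ A ∧ k < G.degreeIn A v := fun v => by simp [H, memA]
  have memW : ∀ v, v ∈ W ↔ v ∈ A ∧ v ∉ H ∧ v ∉ G.compress k A ∧ v ∉ G.rake k A :=
    fun v => by simp only [W, Finset.mem_filter, memA]
  have hdisj : Disjoint H W := Finset.disjoint_left.mpr fun v hv hw => ((memW v).mp hw).2.1 hv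
  have hnbr : ∀ v ∈ A, v ∉ H → v ∉ G.compress k A → ∃ h ∈ H, G.Adj v h := by
    intro v hv hvH hvC
    by_contra hcon
    push Not at hcon
    refine hvC ⟨hv, ?_, fun w hw hwA => ?_⟩
    · by_contra hlt
      exact hvH ((memH v).mpr ⟨hv, not_le.mp hlt⟩)
    · by_contra hlt
      exact hcon w ((memH w).mpr ⟨hwA, not_le.mp hlt⟩) hw
  have hHB : ∀ v ∈ H, v ∈ B := fun v hv =>
    ⟨((memH v).mp hv).1, fun hc => (not_lt.mpr hc.2.1) ((memH v).mp hv).2⟩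
  have hWdeg : ∀ w ∈ W, 2 ≤ G.degreeIn ((H ∪ W : Finset V) : Set V) w := by
    intro w hw
    obtain ⟨hwA, hwH, hwC, hwR⟩ := (memW w).mp hw
    have h2 : 2 ≤ G.degreeIn B w := by
      by_contra hlt
      exact hwR ⟨hwA, hwC, by change G.degreeIn B w ≤ 1; omega⟩
    refine h2.trans (Set.ncard_le_ncard ?_ (Set.toFinite _))
    rintro u ⟨hwu, huA, huC⟩
    refine ⟨hwu, ?_⟩
    rw [Finset.coe_union]
    by_cases huH : u ∈ H
    · exact Or.inl huH
    refine Or.inr ((memW u).mpr ⟨huA, huH, huC, fun hr => ?_⟩)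
    obtain ⟨h, hh, huh⟩ := hnbr u huA huH huC
    have hne : w ≠ h := fun e => hwH (e ▸ hh)
    have : ({w, h} : Set V).ncard ≤ G.degreeIn B u := by
      refine Set.ncard_le_ncard ?_ (Set.toFinite _)
      rintro x (rfl | rfl)
      · exact ⟨hwu.symm, hwA, hwC⟩
      · exact ⟨huh, hHB _ hh⟩
    rw [Set.ncard_pair hne] at this
    have := this.trans hr.2.2
    omega
  have hHdeg : W.card ≤ ∑ h ∈ H, G.degreeIn ((H ∪ W : Finset V) : Set V) h := by
    calc W.card ≤ (H.biUnion fun h => W.filter fun w => G.Adj h w).card := by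
          refine Finset.card_le_card fun w hw => ?_
          obtain ⟨hwA, hwH, hwC, -⟩ := (memW w).mp hw
          obtain ⟨h, hh, hwh⟩ := hnbr w hwA hwH hwC
          simp only [Finset.mem_biUnion, Finset.mem_filter]
          exact ⟨h, hh, hw, hwh.symm⟩
      _ ≤ ∑ h ∈ H, (W.filter fun w => G.Adj h w).card := Finset.card_biUnion_le
      _ ≤ _ := Finset.sum_le_sum fun h _ => by
          rw [← Set.ncard_coe_finset]
          refine Set.ncard_le_ncard ?_ (Set.toFinite _)
          intro w hw
          have hw' := Finset.mem_filter.mp (Finset.mem_coe.mp hw)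
          exact ⟨hw'.2, by simp [hw'.1]⟩
  have hsum := hG.sum_degreeIn_le G (H ∪ W)
  rw [Finset.sum_union hdisj, Finset.card_union_of_disjoint hdisj] at hsum
  have hW2 : 2 * W.card ≤ ∑ w ∈ W, G.degreeIn ((H ∪ W : Finset V) : Set V) w := by
    calc 2 * W.card = ∑ w ∈ W, 2 := by simp [mul_comm]
      _ ≤ _ := Finset.sum_le_sum hWdeg
  have hle : (G.peel k (i + 1)).ncard ≤ H.card + W.card := by
    rw [← Finset.card_union_of_disjoint hdisj, ← Set.ncard_coe_finset]
    refine Set.ncard_le_ncard ?_ (Set.toFinite _)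
    rintro v ⟨hvA, hvC, hvR⟩
    rw [Finset.coe_union]
    by_cases hvH : v ∈ H
    · exact Or.inl hvH
    · exact Or.inr ((memW v).mpr ⟨hvA, hvH, hvC, hvR⟩)
  have hcard : A.ncard = AF.card := by rw [← hAF, Set.ncard_coe_finset]
  have h3 : (G.peel k (i + 1)).ncard ≤ 3 * H.card := by omega
  calc (k + 1) * (G.peel k (i + 1)).ncard ≤ (k + 1) * (3 * H.card) := by gcongr
    _ = 3 * ((k + 1) * H.card) := by ring
    _ ≤ 3 * (2 * AF.card) := by gcongr
    _ = 6 * A.ncard := by rw [hcard]; ring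

/-- Since `36 ≤ k`, the factor `6 / (k + 1)` is at most `1 / √k`; squaring avoids the root. -/
theorem IsAcyclic.pow_mul_ncard_peel_le [Finite V] (hG : G.IsAcyclic) (hk : 36 ≤ k) (i : ℕ) :
    k ^ i * (G.peel k i).ncard ^ 2 ≤ Nat.card V ^ 2 := by
  induction i with
  | zero => simp [peel, Set.ncard_univ]
  | succ i ih =>
    refine le_trans ?_ ih
    have h := Nat.pow_le_pow_left (hG.ncard_peel_succ_le G k i) 2
    set a := (G.peel k (i + 1)).ncard
    set b := (G.peel k i).ncard
    have h2 : k * a ^ 2 ≤ b ^ 2 := by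
      have h4 : (k * a ^ 2) * k ≤ b ^ 2 * k := by
        calc (k * a ^ 2) * k ≤ ((k + 1) * a) ^ 2 := by
              rw [mul_pow]
              nlinarith [Nat.zero_le (a ^ 2), Nat.zero_le (k * a ^ 2)]
          _ ≤ (6 * b) ^ 2 := h
          _ = b ^ 2 * 36 := by ring
          _ ≤ b ^ 2 * k := by gcongr
      exact Nat.le_of_mul_le_mul_right h4 (by omega)
    calc k ^ (i + 1) * a ^ 2 = k ^ i * (k * a ^ 2) := by ring
      _ ≤ k ^ i * b ^ 2 := by gcongr

theorem IsAcyclic.peel_eq_empty [Finite V] (hG : G.IsAcyclic) (hk : 36 ≤ k) :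
    G.peel k (Nat.log k (Nat.card V ^ 2) + 1) = ∅ := by
  by_contra hne
  have hpos : 0 < (G.peel k (Nat.log k (Nat.card V ^ 2) + 1)).ncard := by
    rw [Set.ncard_pos]
    exact Set.nonempty_iff_ne_empty.mpr hne
  have h1 := hG.pow_mul_ncard_peel_le G k hk (Nat.log k (Nat.card V ^ 2) + 1)
  have h2 := Nat.lt_pow_succ_log_self (b := k) (by omega) (Nat.card V ^ 2)
  have h3 := Nat.le_mul_of_pos_right (k ^ (Nat.log k (Nat.card V ^ 2) + 1)) (Nat.pow_pos hpos (n := 2))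
  exact absurd (h3.trans h1) (not_le.mpr h2)

/-- The vertices that are compressed in one of the first `l` iterations. -/
def compressed (l : ℕ) : Set V := {v | ∃ i < l, v ∈ G.compress k (G.peel k i)}

/-- Take the first iteration in which `v` or a neighbour of `v` is compressed. All compressed
neighbours of `v` are still present then, and the condition on neighbours in `compress` bounds the
degree of `v` even if only a neighbour is compressed. -/
theorem degreeIn_compressed_le [Finite V] (l : ℕ) {v : V} (hv : v ∈ G.compressed k l) :
    G.degreeIn (G.compressed k l) v ≤ k := by
  classical
  have hex : ∃ i, v ∈ G.compress k (G.peel k i) ∨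
      ∃ w, G.Adj v w ∧ w ∈ G.compress k (G.peel k i) := by
    obtain ⟨i, -, hi⟩ := hv
    exact ⟨i, Or.inl hi⟩
  have hmin : ∀ j, (v ∈ G.compress k (G.peel k j) ∨
      ∃ w, G.Adj v w ∧ w ∈ G.compress k (G.peel k j)) → Nat.find hex ≤ j :=
    fun j hj => Nat.find_min' hex hj
  have hi := Nat.find_spec hex
  set i := Nat.find hex
  have hvi : v ∈ G.peel k i := by
    obtain ⟨j, -, hj⟩ := hv
    exact G.peel_antitone k (hmin j (Or.inl hj)) hj.1
  have hle : G.degreeIn (G.compressed k l) v ≤ G.degreeIn (G.peel k i) v := by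
    refine Set.ncard_le_ncard ?_ (Set.toFinite _)
    rintro w ⟨hvw, j, -, hj⟩
    exact ⟨hvw, G.peel_antitone k (hmin j (Or.inr ⟨w, hvw, hj⟩)) hj.1⟩
  refine hle.trans ?_
  rcases hi with hi | ⟨w, hvw, hw⟩
  · exact hi.2.1
  · exact hw.2.2 v hvw.symm hvi

/-- The subgraph of `G` (on the same vertex set) spanned by the vertices in `U`. -/
def restrictTo (U : Set V) : SimpleGraph V where
  Adj v w := G.Adj v w ∧ v ∈ U ∧ w ∈ U
  symm := ⟨fun _ _ h => ⟨h.1.symm, h.2.2, h.2.1⟩⟩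
  loopless := ⟨fun _ h => h.1.ne rfl⟩

variable {G}

/-- If every vertex has at most one neighbour of the same or a higher level, then a path that starts
with a non-ascending step keeps descending. -/
theorem length_le_of_level_descending {lv : V → ℕ}
    (h : ∀ v w w', G.Adj v w → G.Adj v w' → lv v ≤ lv w → lv v ≤ lv w' → w = w') {v u : V}
    (p : G.Walk v u) : ∀ {x : V} (hx : G.Adj x v), (Walk.cons hx p).IsPath → lv v ≤ lv x →
    p.length ≤ lv v := by
  induction p with
  | nil => intros; simp
  | @cons a b _ hab q ih =>
    intro x hx hp hle
    rw [Walk.cons_isPath_iff] at hp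
    have hne : x ≠ b := by
      rintro rfl
      exact hp.2 (by simp)
    have hlt : lv b < lv a := by
      by_contra hcon
      exact hne (h a x b hx.symm hab hle (not_lt.mp hcon))
    have := ih hab hp.1 hlt.le
    simp only [Walk.length_cons]
    omega

/-- Levels along a path first strictly increase and, after the first non-ascending step, strictly
decrease. Adding `lv v` to the length lets an ascending step pay for itself in the induction. -/
theorem length_le_of_level {lv : V → ℕ} {l : ℕ} (hl : ∀ v, lv v < l)
    (h : ∀ v w w', G.Adj v w → G.Adj v w' → lv v ≤ lv w → lv v ≤ lv w' → w = w') {v u : V}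
    (p : G.Walk v u) (hp : p.IsPath) : p.length + lv v ≤ 2 * l := by
  induction p with
  | @nil x =>
    have := hl x
    simp only [Walk.length_nil]
    omega
  | @cons a b _ hab q ih =>
    have ha := hl a
    have hb := hl b
    simp only [Walk.length_cons]
    by_cases hle : lv b ≤ lv a
    · have := length_le_of_level_descending h q hab hp hle
      omega
    · have := ih (Walk.cons_isPath_iff _ _ |>.mp hp).1
      omega

/-- The components of the uncompressed part have diameter at most `2 l`. -/
theorem exists_walk_length_le_of_peel_eq_empty [Finite V] {l : ℕ} (hl : G.peel k l = ∅) {v u : V}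
    (hvu : (G.restrictTo (G.compressed k l)ᶜ).Reachable v u) :
    ∃ p : (G.restrictTo (G.compressed k l)ᶜ).Walk v u, p.length ≤ 2 * l := by
  classical
  -- The level of an uncompressed vertex is the iteration that rakes it; compressed vertices get an
  -- irrelevant value.
  have hlev : ∀ v, ∃ i < l, v ∉ G.compressed k l → v ∈ G.rake k (G.peel k i) := by
    intro v
    by_contra! hcon
    have : ∀ i ≤ l, v ∈ G.peel k i := by
      intro i
      induction i with
      | zero => intro _; trivial
      | succ i ih =>
        intro hi
        obtain ⟨hvC, hvR⟩ := hcon i hi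
        exact ⟨ih (by omega), fun hc => hvC ⟨i, hi, hc⟩, hvR⟩
    have := this l le_rfl
    rw [hl] at this
    exact this
  choose lv hlv hrake using hlev
  obtain ⟨p, hp⟩ := hvu.exists_isPath
  refine ⟨p, le_trans (Nat.le_add_right _ (lv v)) (length_le_of_level hlv ?_ p hp)⟩
  rintro a w w' ⟨haw, ha, hw⟩ ⟨haw', -, hw'⟩ hle hle'
  obtain ⟨-, -, hdeg⟩ := hrake a ha
  have hmem : ∀ x, x ∉ G.compressed k l → lv a ≤ lv x →
      x ∈ G.peel k (lv a) \ G.compress k (G.peel k (lv a)) := fun x hx hax =>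
    ⟨G.peel_antitone k hax (hrake x hx).1, fun hc => hx ⟨lv a, hlv a, hc⟩⟩
  -- Two neighbours of at least the same level would both still be present when `a` is raked,
  -- against its degree bound 1.
  by_contra hne
  have : ({w, w'} : Set V).ncard ≤ G.degreeIn (G.peel k (lv a) \ G.compress k (G.peel k (lv a))) a := by
    refine Set.ncard_le_ncard ?_ (Set.toFinite _)
    rintro x (rfl | rfl)
    · exact ⟨haw, hmem _ hw hle⟩
    · exact ⟨haw', hmem _ hw' hle'⟩
  rw [Set.ncard_pair hne] at this
  omega

end SimpleGraph

/-! ### Comparing neighbourhoods in two networks -/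

theorem SimpleGraph.exists_walk_length_le_of_edist_le {V : Type*} {G : SimpleGraph V} {u v : V}
    {T : ℕ} (h : G.edist u v ≤ T) : ∃ p : G.Walk u v, p.length ≤ T := by
  obtain ⟨p, hp⟩ := G.exists_walk_of_edist_ne_top (ne_top_of_le_ne_top (ENat.natCast_ne_top T) h)
  exact ⟨p, by rw [← hp] at h; exact_mod_cast h⟩

theorem SimpleGraph.edist_le_add_one {V : Type*} {G : SimpleGraph V} {u v w : V}
    (h : G.Adj v w) : G.edist u w ≤ G.edist u v + 1 :=
  G.edist_triangle.trans (by gcongr; exact (G.edist_eq_one_iff_adj.mpr h).le)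

theorem SemiGraph.edist_underlying_le_one {V E : Type} (S : SemiGraph V E) {v w : V} {e : E}
    (hv : S.Inc v e) (hw : S.Inc w e) : S.underlying.edist v w ≤ 1 := by
  rw [SimpleGraph.edist_le_one_iff_adj_or_eq]
  by_cases h : v = w
  · exact Or.inr h
  · exact Or.inl ⟨h, e, hv, hw⟩

namespace LocalInput

variable {V E V' E' : Type} {S : SemiGraph V E} {S' : SemiGraph V' E'} {c : ℕ}
  {I : LocalInput S c} {I' : LocalInput S' c} {T : ℕ} {v : V} {v' : V'}

/-- The walk is retraced link by link in the other network, identifiers fixing the endpoints. The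
length budget keeps the start of every link at distance less than `T + 1` from `v`, so that the view
records it. -/
theorem exists_walk_of_view_eq (h : I.view (T + 1) v = I'.view (T + 1) v') {u a : V} {u' : V'}
    (hu : I.ident u = I'.ident u') (p : S.underlying.Walk u a)
    (hp : S.underlying.edist v u + p.length ≤ (T + 1 : ℕ)) :
    ∃ a', I.ident a = I'.ident a' ∧ S'.underlying.edist u' a' ≤ p.length := by
  induction p generalizing u' with
  | nil => exact ⟨u', hu, by simp⟩
  | @cons u b a hub p ih =>
    have hlt : S.underlying.edist v u < (T + 1 : ℕ) := by
      have : S.underlying.edist v u + 1 ≤ (T + 1 : ℕ) := by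
        refine le_trans ?_ hp
        gcongr
        simp
      exact ENat.add_one_le_iff (ne_top_of_le_ne_top (ENat.natCast_ne_top _)
        (le_self_add.trans this)) |>.mp this
    obtain ⟨hne, e, hue, hbe⟩ := id hub
    have hmem : (I.ident u, I.port u e, I.ident b, I.port b e) ∈ (I.view (T + 1) v).links :=
      ⟨u, b, e, by exact_mod_cast hlt, hne, hue, hbe, rfl⟩
    rw [h] at hmem
    obtain ⟨u'', b', e', -, hne', hue', hbe', heq⟩ := hmem
    simp only [Prod.mk.injEq] at heq
    have : u'' = u' := I'.ident_injective (heq.1.symm.trans hu)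
    subst this
    obtain ⟨a', ha', hd⟩ := ih heq.2.2.1 (by
      refine le_trans ?_ hp
      refine (add_le_add_left (S.underlying.edist_le_add_one hub) _).trans ?_
      rw [SimpleGraph.Walk.length_cons]
      push_cast
      rw [add_assoc, add_comm (1 : ℕ∞)])
    refine ⟨a', ha', ?_⟩
    rw [SimpleGraph.Walk.length_cons]
    push_cast
    have h1 : S'.underlying.edist u'' b' ≤ 1 :=
      S'.edist_underlying_le_one hue' hbe'
    calc _ ≤ S'.underlying.edist u'' b' + S'.underlying.edist b' a' :=
          S'.underlying.edist_triangle
      _ ≤ 1 + p.length := add_le_add h1 hd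
      _ = _ := add_comm _ _

theorem exists_edist_of_view_eq (h : I.view (T + 1) v = I'.view (T + 1) v') {u : V} {u' : V'}
    (hu : I.ident u = I'.ident u') (hvu : S.underlying.edist v u ≤ 1) {a : V} {j : ℕ} (hj : j ≤ T)
    (ha : S.underlying.edist u a ≤ j) :
    ∃ a', I.ident a = I'.ident a' ∧ S'.underlying.edist u' a' ≤ j ∧
      S.underlying.edist v a ≤ (j + 1 : ℕ) := by
  obtain ⟨p, hp⟩ := SimpleGraph.exists_walk_length_le_of_edist_le ha
  obtain ⟨a', h1, h2⟩ := exists_walk_of_view_eq h hu p (by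
    calc _ ≤ (1 : ℕ∞) + (T : ℕ) := add_le_add hvu (by exact_mod_cast hp.trans hj)
      _ = _ := by push_cast; rw [add_comm])
  refine ⟨a', h1, h2.trans (by exact_mod_cast hp), ?_⟩
  calc _ ≤ _ := S.underlying.edist_triangle (v := u)
    _ ≤ (1 : ℕ∞) + j := add_le_add hvu ha
    _ = _ := by push_cast; rw [add_comm]

/-- Equality of the larger views yields the same fact somewhere around `v'`; retracing a walk from
`u`, together with injectivity of identifiers, shows that it lies close enough to `u'`. -/
theorem view_le_of_view_eq (h : I.view (T + 1) v = I'.view (T + 1) v') {u : V} {u' : V'}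
    (hu : I.ident u = I'.ident u') (hvu : S.underlying.edist v u ≤ 1) :
    (I.view T u).nodes ⊆ (I'.view T u').nodes ∧ (I.view T u).ends ⊆ (I'.view T u').ends ∧
      (I.view T u).links ⊆ (I'.view T u').links := by
  refine ⟨?_, ?_, ?_⟩
  · rintro x ⟨a, ha, rfl⟩
    obtain ⟨a', h1, h2, h3⟩ := exists_edist_of_view_eq h hu hvu le_rfl ha
    have hmem : (I.ident a, S.degree a) ∈ (I.view (T + 1) v).nodes := ⟨a, h3, rfl⟩
    rw [h] at hmem
    obtain ⟨a'', -, heq⟩ := hmem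
    have : a'' = a' := I'.ident_injective ((Prod.ext_iff.mp heq).1.symm.trans h1)
    subst this
    exact ⟨a'', h2, heq⟩
  · rintro x ⟨a, e, ha, hae, rfl⟩
    obtain ⟨a', h1, h2, h3⟩ := exists_edist_of_view_eq h hu hvu le_rfl ha
    have hmem : (I.ident a, I.port a e, S.rank e) ∈ (I.view (T + 1) v).ends := ⟨a, e, h3, hae, rfl⟩
    rw [h] at hmem
    obtain ⟨a'', e', -, hae', heq⟩ := hmem
    have : a'' = a' := I'.ident_injective ((Prod.ext_iff.mp heq).1.symm.trans h1)
    subst this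
    exact ⟨a'', e', h2, hae', heq⟩
  · rintro x ⟨a, b, e, ha, hab, hae, hbe, rfl⟩
    obtain ⟨j, hj⟩ := ENat.ne_top_iff_exists.mp ha.ne_top
    rw [← hj] at ha
    have hjT : j < T := by exact_mod_cast ha
    obtain ⟨a', h1, h2, h3⟩ := exists_edist_of_view_eq h hu hvu hjT.le hj.ge
    have hmem : (I.ident a, I.port a e, I.ident b, I.port b e) ∈ (I.view (T + 1) v).links :=
      ⟨a, b, e, h3.trans_lt (by exact_mod_cast (by omega : j + 1 < T + 1)), hab, hae, hbe, rfl⟩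
    rw [h] at hmem
    obtain ⟨a'', b', e', -, hne', hae', hbe', heq⟩ := hmem
    have : a'' = a' := I'.ident_injective ((Prod.ext_iff.mp heq).1.symm.trans h1)
    subst this
    exact ⟨a'', b', e', h2.trans_lt (by exact_mod_cast hjT), hne', hae', hbe', heq⟩

/-- One round of communication: for a neighbour `u` this forwards its view, and for `u = v` it
lowers the radius. -/
theorem view_eq_of_view_succ_eq (h : I.view (T + 1) v = I'.view (T + 1) v') {u : V} {u' : V'}
    (hu : I.ident u = I'.ident u') (hvu : S.underlying.edist v u ≤ 1)
    (hvu' : S'.underlying.edist v' u' ≤ 1) : I.view T u = I'.view T u' := by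
  obtain ⟨h1, h2, h3⟩ := view_le_of_view_eq h hu hvu
  obtain ⟨h1', h2', h3'⟩ := view_le_of_view_eq h.symm hu.symm hvu'
  exact LocalView.ext hu (h1.antisymm h1') (h2.antisymm h2') (h3.antisymm h3')

theorem ident_eq_of_view_eq (h : I.view T v = I'.view T v') : I.ident v = I'.ident v' :=
  congrArg LocalView.self h

theorem degree_eq_of_view_eq (h : I.view T v = I'.view T v') : S.degree v = S'.degree v' := by
  have hmem : (I.ident v, S.degree v) ∈ (I.view T v).nodes := ⟨v, by simp, rfl⟩
  rw [h] at hmem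
  obtain ⟨a, -, heq⟩ := hmem
  rw [Prod.mk.injEq] at heq
  have : a = v' := I'.ident_injective (heq.1.symm.trans (ident_eq_of_view_eq h))
  exact this ▸ heq.2

theorem view_eq_of_le {T' : ℕ} (hT : T ≤ T') (h : I.view T' v = I'.view T' v') :
    I.view T v = I'.view T v' := by
  induction hT with
  | refl => exact h
  | step _ ih => exact ih (view_eq_of_view_succ_eq h (ident_eq_of_view_eq h) (by simp) (by simp))

theorem exists_neighbor_of_view_eq (h : I.view (T + 1) v = I'.view (T + 1) v') {w : V} {e : E}
    (hvw : v ≠ w) (hv : S.Inc v e) (hw : S.Inc w e) :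
    ∃ w' e', v' ≠ w' ∧ S'.Inc v' e' ∧ S'.Inc w' e' ∧ I.port v e = I'.port v' e' ∧
      I.port w e = I'.port w' e' ∧ I.view T w = I'.view T w' := by
  have hmem : (I.ident v, I.port v e, I.ident w, I.port w e) ∈ (I.view (T + 1) v).links :=
    ⟨v, w, e, by simp, hvw, hv, hw, rfl⟩
  rw [h] at hmem
  obtain ⟨a, w', e', -, hne, hae, hwe, heq⟩ := hmem
  simp only [Prod.mk.injEq] at heq
  have : a = v' := I'.ident_injective (heq.1.symm.trans (ident_eq_of_view_eq h))
  subst this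
  refine ⟨w', e', hne, hae, hwe, heq.2.1, heq.2.2.2, view_eq_of_view_succ_eq h heq.2.2.1 ?_ ?_⟩
  · exact S.edist_underlying_le_one hv hw
  · exact S'.edist_underlying_le_one hae hwe

end LocalInput

/-! ### Locally computable quantities on trees -/

/-- A tree on `n` nodes together with identifiers and port numbers. -/
structure TreeInput (n c : ℕ) where
  V : Type
  finite : Finite V
  card_eq : Nat.card V = n
  G : SimpleGraph V
  isTree : G.IsTree
  I : LocalInput (SemiGraph.ofGraph G) c

attribute [instance] TreeInput.finite

namespace TreeInput

variable {n c : ℕ}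

open Classical in
/-- The port of `v` that leads to its neighbour `w`. -/
noncomputable def portTo (D : TreeInput n c) (v w : D.V) : ℕ :=
  if h : D.G.Adj v w then D.I.port v ⟨s(v, w), h⟩ else 0

theorem portTo_eq (D : TreeInput n c) {v w : D.V} (h : D.G.Adj v w) :
    D.portTo v w = D.I.port v ⟨s(v, w), h⟩ := dif_pos h

theorem portTo_eq' (D : TreeInput n c) {v w : D.V} (h : D.G.Adj v w) :
    D.portTo w v = D.I.port w ⟨s(v, w), h⟩ := by
  rw [D.portTo_eq h.symm]
  congr 2
  exact Sym2.eq_swap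

theorem inc_left (D : TreeInput n c) {v w : D.V} (h : D.G.Adj v w) :
    (SemiGraph.ofGraph D.G).Inc v ⟨s(v, w), h⟩ := Sym2.mem_mk_left v w

theorem inc_right (D : TreeInput n c) {v w : D.V} (h : D.G.Adj v w) :
    (SemiGraph.ofGraph D.G).Inc w ⟨s(v, w), h⟩ := Sym2.mem_mk_right v w

theorem portTo_injOn (D : TreeInput n c) (v : D.V) :
    Set.InjOn (D.portTo v) {w | D.G.Adj v w} := by
  intro w hw w' hw' heq
  rw [D.portTo_eq hw, D.portTo_eq hw'] at heq
  have := (D.I.port_bijOn v).injOn (D.inc_left hw) (D.inc_left hw') heq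
  exact Sym2.congr_right.mp (Subtype.ext_iff.mp this)

theorem exists_adj_of_view_eq {D D' : TreeInput n c} {T : ℕ} {v : D.V} {v' : D'.V}
    (h : D.I.view (T + 1) v = D'.I.view (T + 1) v') {w : D.V} (hw : D.G.Adj v w) :
    ∃ w', D'.G.Adj v' w' ∧ D.portTo v w = D'.portTo v' w' ∧ D.portTo w v = D'.portTo w' v' ∧
      D.I.view T w = D'.I.view T w' := by
  obtain ⟨w', ⟨e', he'⟩, hne, hv', hw', h1, h2, h3⟩ :=
    LocalInput.exists_neighbor_of_view_eq h hw.ne (D.inc_left hw) (D.inc_right hw)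
  obtain rfl : e' = s(v', w') := (Sym2.mem_and_mem_iff hne).mp ⟨hv', hw'⟩
  refine ⟨w', he', ?_, ?_, h3⟩
  · rw [D.portTo_eq hw, D'.portTo_eq he', h1]
  · rw [D.portTo_eq' hw, D'.portTo_eq' he', h2]

/-- The quantity `X` depends only on the `T`-hop neighbourhood. -/
def IsLocal {α : Type*} (T : ℕ) (X : (D : TreeInput n c) → D.V → α) : Prop :=
  ∀ (D D' : TreeInput n c) (v : D.V) (v' : D'.V),
    D.I.view T v = D'.I.view T v' → X D v = X D' v'

namespace IsLocal

variable {α β : Type*} {T T' : ℕ} {X : (D : TreeInput n c) → D.V → α}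
  {Y : (D : TreeInput n c) → D.V → β} {A : (D : TreeInput n c) → Set D.V}

theorem mono (hX : IsLocal T X) (h : T ≤ T') : IsLocal T' X :=
  fun D D' v v' hv => hX D D' v v' (LocalInput.view_eq_of_le h hv)

theorem comp (hX : IsLocal T X) (φ : α → β) : IsLocal T fun D v => φ (X D v) :=
  fun D D' v v' hv => congrArg φ (hX D D' v v' hv)

theorem prodMk (hX : IsLocal T X) (hY : IsLocal T Y) : IsLocal T fun D v => (X D v, Y D v) :=
  fun D D' v v' hv => Prod.ext (hX D D' v v' hv) (hY D D' v v' hv)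

theorem ident : IsLocal T fun (D : TreeInput n c) v => D.I.ident v :=
  fun _ _ _ _ hv => LocalInput.ident_eq_of_view_eq hv

theorem degree : IsLocal T fun (D : TreeInput n c) v => (SemiGraph.ofGraph D.G).degree v :=
  fun _ _ _ _ hv => LocalInput.degree_eq_of_view_eq hv

/-- What a node knows about its neighbours after one more round. -/
theorem neighbors (hX : IsLocal T X) : IsLocal (T + 1) fun (D : TreeInput n c) v =>
    {x : ℕ × ℕ × α | ∃ w, D.G.Adj v w ∧ x = (D.portTo v w, D.portTo w v, X D w)} := by
  have key : ∀ (D D' : TreeInput n c) (v : D.V) (v' : D'.V),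
      D.I.view (T + 1) v = D'.I.view (T + 1) v' →
      {x : ℕ × ℕ × α | ∃ w, D.G.Adj v w ∧ x = (D.portTo v w, D.portTo w v, X D w)} ⊆
        {x : ℕ × ℕ × α | ∃ w, D'.G.Adj v' w ∧ x = (D'.portTo v' w, D'.portTo w v', X D' w)} := by
    rintro D D' v v' hv x ⟨w, hw, rfl⟩
    obtain ⟨w', hw', h1, h2, h3⟩ := exists_adj_of_view_eq hv hw
    exact ⟨w', hw', by rw [h1, h2, hX D D' w w' h3]⟩
  exact fun D D' v v' hv => (key D D' v v' hv).antisymm (key D' D v' v hv.symm)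

theorem mem_not (hA : IsLocal T fun D v => v ∈ A D) : IsLocal T fun D v => v ∉ A D :=
  hA.comp Not

theorem degreeIn (hA : IsLocal T fun D v => v ∈ A D) :
    IsLocal (T + 1) fun D v => D.G.degreeIn (A D) v := by
  have h := hA.neighbors.comp fun s : Set (ℕ × ℕ × Prop) => ((fun x => x.1) '' {x ∈ s | x.2.2}).ncard
  convert h using 3 with D v
  -- The facts about neighbours form a set, so neighbours are counted by their ports, which are
  -- distinct.
  rw [SimpleGraph.degreeIn, ← Set.InjOn.ncard_image
    ((D.portTo_injOn v).mono (s₁ := {w | D.G.Adj v w ∧ w ∈ A D}) fun w hw => hw.1)]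
  congr 1
  ext p
  constructor
  · rintro ⟨w, ⟨hw, hwA⟩, rfl⟩
    exact ⟨_, ⟨⟨w, hw, rfl⟩, hwA⟩, rfl⟩
  · rintro ⟨_, ⟨⟨w, hw, rfl⟩, hwA⟩, rfl⟩
    exact ⟨w, ⟨hw, hwA⟩, rfl⟩

theorem forall_neighbor (hX : IsLocal T X) (p : α → Prop) :
    IsLocal (T + 1) fun D v => ∀ w, D.G.Adj v w → p (X D w) := by
  have h := hX.neighbors.comp fun s : Set (ℕ × ℕ × α) => ∀ x ∈ s, p x.2.2
  convert h using 3 with D v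
  constructor
  · rintro hp _ ⟨w, hw, rfl⟩
    exact hp w hw
  · exact fun hp w hw => hp _ ⟨w, hw, rfl⟩

theorem compress (k : ℕ) (hA : IsLocal T fun D v => v ∈ A D) :
    IsLocal (T + 2) fun D v => v ∈ D.G.compress k (A D) := by
  have h1 := (hA.mono (Nat.le_succ T)).prodMk hA.degreeIn
  exact ((h1.mono (Nat.le_succ _)).prodMk
    (h1.forall_neighbor fun x => x.1 → x.2 ≤ k)).comp fun x => x.1.1 ∧ x.1.2 ≤ k ∧ x.2

theorem rake (k : ℕ) (hA : IsLocal T fun D v => v ∈ A D) :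
    IsLocal (T + 3) fun D v => v ∈ D.G.rake k (A D) := by
  have h1 : IsLocal (T + 2) fun D v => v ∈ A D \ D.G.compress k (A D) :=
    ((hA.mono (Nat.le_add_right T 2)).prodMk (hA.compress k)).comp fun x => x.1 ∧ ¬ x.2
  have h2 := ((h1.mono (Nat.le_succ _)).prodMk h1.degreeIn).comp fun x => x.1 ∧ x.2 ≤ 1
  convert h2 using 3 with D v
  exact and_assoc.symm

/-- An iteration costs three rounds: two for the degrees of a vertex and of its neighbours, one for
the degree after compressing. -/
theorem peel (k i : ℕ) :
    IsLocal (3 * i) fun (D : TreeInput n c) v => v ∈ D.G.peel k i := by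
  induction i with
  | zero => exact fun _ _ _ _ _ => rfl
  | succ i ih =>
    exact ((ih.mono (Nat.le_add_right _ 3)).prodMk (((ih.compress k).mono (Nat.le_succ _)).prodMk
      (ih.rake k))).comp fun x => x.1 ∧ ¬ x.2.1 ∧ ¬ x.2.2

theorem compressed (k l : ℕ) :
    IsLocal (3 * l) fun (D : TreeInput n c) v => v ∈ D.G.compressed k l := by
  intro D D' v v' hv
  simp only [SimpleGraph.compressed, Set.mem_ofPred_eq, eq_iff_iff]
  refine exists_congr fun i => and_congr_right fun hi => ?_
  exact iff_of_eq (((peel k i).compress k).mono (by omega) D D' v v' hv)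

end IsLocal

/-- Each step uses up one unit of radius, and at least `T` units remain at every vertex of the walk
to decide membership in `U`. -/
theorem exists_walk_restrictTo_of_view_eq {T : ℕ} {U : (D : TreeInput n c) → Set D.V}
    (hU : IsLocal T fun D v => v ∈ U D) {D D' : TreeInput n c} {v u : D.V}
    (p : (D.G.restrictTo (U D)).Walk v u) : ∀ {v' : D'.V},
    D.I.view (T + p.length) v = D'.I.view (T + p.length) v' →
    ∃ (u' : D'.V) (q : (D'.G.restrictTo (U D')).Walk v' u'),
      q.length = p.length ∧ D.I.view T u = D'.I.view T u' := by
  induction p with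
  | nil => exact fun {v'} h => ⟨v', .nil, rfl, h⟩
  | @cons a b _ hab p ih =>
    intro v' h
    obtain ⟨w', hw', -, -, h3⟩ := exists_adj_of_view_eq (T := T + p.length) h hab.1
    obtain ⟨u', q, hq, hu⟩ := ih h3
    have hadj : (D'.G.restrictTo (U D')).Adj v' w' :=
      ⟨hw', (iff_of_eq (hU.mono (Nat.le_add_right _ _) D D' a v' h)).mp hab.2.1,
        (iff_of_eq (hU.mono (Nat.le_add_right _ _) D D' b w' h3)).mp hab.2.2⟩
    exact ⟨u', .cons hadj q, by rw [SimpleGraph.Walk.length_cons, SimpleGraph.Walk.length_cons, hq],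
      hu⟩

/-- What a node can learn about the nodes that it reaches within `j` steps inside the set `U`. -/
theorem IsLocal.ball {α : Type*} {T j : ℕ} {U : (D : TreeInput n c) → Set D.V}
    {X : (D : TreeInput n c) → D.V → α} (hU : IsLocal T fun D v => v ∈ U D) (hX : IsLocal T X) :
    IsLocal (T + j) fun (D : TreeInput n c) v =>
      {x : α | ∃ u, (D.G.restrictTo (U D)).edist v u ≤ j ∧ x = X D u} := by
  have key : ∀ (D D' : TreeInput n c) (v : D.V) (v' : D'.V),
      D.I.view (T + j) v = D'.I.view (T + j) v' →
      {x : α | ∃ u, (D.G.restrictTo (U D)).edist v u ≤ j ∧ x = X D u} ⊆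
        {x : α | ∃ u, (D'.G.restrictTo (U D')).edist v' u ≤ j ∧ x = X D' u} := by
    rintro D D' v v' hv x ⟨u, hu, rfl⟩
    obtain ⟨p, hp⟩ := SimpleGraph.exists_walk_length_le_of_edist_le hu
    obtain ⟨u', q, hq, h⟩ := exists_walk_restrictTo_of_view_eq hU p
      (LocalInput.view_eq_of_le (by omega) hv)
    refine ⟨u', (SimpleGraph.edist_le q).trans ?_, hX D D' u u' h⟩
    exact_mod_cast hq.le.trans hp
  exact fun D D' v v' hv => (key D D' v v' hv).antisymm (key D' D v' v hv.symm)

/-- A local labeling rule is the output function of an algorithm. -/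
theorem IsLocal.exists_out {α : Type*} [Nonempty α] {T : ℕ}
    {X : (D : TreeInput n c) → D.V → α} (hX : IsLocal T X) :
    ∃ out : LocalView → α, ∀ (D : TreeInput n c) (v : D.V), out (D.I.view T v) = X D v := by
  -- Locality makes the value well defined on views that occur; the others get an arbitrary one.
  have h : ∀ w : LocalView, ∃ a : α, ∀ (D : TreeInput n c) (v : D.V), D.I.view T v = w → a = X D v := by
    intro w
    by_cases hw : ∃ (D : TreeInput n c) (v : D.V), D.I.view T v = w
    · obtain ⟨D, v, rfl⟩ := hw
      exact ⟨X D v, fun D' v' h' => hX D D' v v' h'.symm⟩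
    · exact ⟨Classical.arbitrary α, fun D v h' => absurd ⟨D, v, h'⟩ hw⟩
  choose out hout using h
  exact ⟨out, fun D v => hout _ D v rfl⟩

end TreeInput

/-! ### Restriction to a node set and disjoint union of semi-graphs -/

namespace SemiGraph

variable {V E V₁ E₁ V₂ E₂ : Type}

/-- The semi-graph that keeps the half-edges at the nodes in `U`. -/
def restrictNodes (S : SemiGraph V E) (U : Set V) : SemiGraph V E where
  Inc v e := S.Inc v e ∧ v ∈ U
  rank_le_two e := (Set.encard_le_encard fun _ h => h.1).trans (S.rank_le_two e)

theorem degree_restrictNodes_of_mem (S : SemiGraph V E) {U : Set V} {v : V} (hv : v ∈ U) :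
    (S.restrictNodes U).degree v = S.degree v := by
  simp [degree, restrictNodes, hv]

theorem degree_restrictNodes_of_notMem (S : SemiGraph V E) {U : Set V} {v : V} (hv : v ∉ U) :
    (S.restrictNodes U).degree v = 0 := by
  simp [degree, restrictNodes, hv]

theorem rank_restrictNodes_add [Finite V] (S : SemiGraph V E) (U : Set V) (e : E) :
    (S.restrictNodes Uᶜ).rank e + (S.restrictNodes U).rank e = S.rank e := by
  have := Set.ncard_inter_add_ncard_sdiff_eq_ncard {v | S.Inc v e} U (Set.toFinite _)
  rw [add_comm]
  exact this

/-- The disjoint union of two semi-graphs. -/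
def sum (S₁ : SemiGraph V₁ E₁) (S₂ : SemiGraph V₂ E₂) : SemiGraph (V₁ ⊕ V₂) (E₁ ⊕ E₂) where
  Inc
    | .inl v, .inl e => S₁.Inc v e
    | .inr v, .inr e => S₂.Inc v e
    | _, _ => False
  rank_le_two
    | .inl e => by
      refine le_trans (le_of_eq ?_) (S₁.rank_le_two e)
      rw [← Sum.inl_injective.encard_image (β := V₁ ⊕ V₂)]
      congr 1
      ext (v | v) <;> simp
    | .inr e => by
      refine le_trans (le_of_eq ?_) (S₂.rank_le_two e)
      rw [← Sum.inr_injective.encard_image (β := V₁ ⊕ V₂)]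
      congr 1
      ext (v | v) <;> simp

section sum

variable (S₁ : SemiGraph V₁ E₁) (S₂ : SemiGraph V₂ E₂)

@[simp] theorem sum_inc_inl_inl (v : V₁) (e : E₁) :
    (S₁.sum S₂).Inc (.inl v) (.inl e) ↔ S₁.Inc v e := Iff.rfl
@[simp] theorem sum_inc_inr_inr (v : V₂) (e : E₂) :
    (S₁.sum S₂).Inc (.inr v) (.inr e) ↔ S₂.Inc v e := Iff.rfl
@[simp] theorem sum_inc_inl_inr (v : V₁) (e : E₂) : ¬ (S₁.sum S₂).Inc (.inl v) (.inr e) := id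
@[simp] theorem sum_inc_inr_inl (v : V₂) (e : E₁) : ¬ (S₁.sum S₂).Inc (.inr v) (.inl e) := id

theorem setOf_sum_inc_inl (v : V₁) :
    {e | (S₁.sum S₂).Inc (.inl v) e} = Sum.inl '' {e | S₁.Inc v e} := by
  ext (e | e) <;> simp

theorem setOf_sum_inc_inr (v : V₂) :
    {e | (S₁.sum S₂).Inc (.inr v) e} = Sum.inr '' {e | S₂.Inc v e} := by
  ext (e | e) <;> simp

@[simp] theorem sum_degree_inl (v : V₁) : (S₁.sum S₂).degree (.inl v) = S₁.degree v := by
  rw [degree, setOf_sum_inc_inl, Set.ncard_image_of_injective _ Sum.inl_injective, degree]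

@[simp] theorem sum_degree_inr (v : V₂) : (S₁.sum S₂).degree (.inr v) = S₂.degree v := by
  rw [degree, setOf_sum_inc_inr, Set.ncard_image_of_injective _ Sum.inr_injective, degree]

@[simp] theorem sum_rank_inl (e : E₁) : (S₁.sum S₂).rank (.inl e) = S₁.rank e := by
  rw [rank, rank, ← Set.ncard_image_of_injective _ (Sum.inl_injective (α := V₁) (β := V₂))]
  congr 1
  ext (v | v) <;> simp

@[simp] theorem sum_underlying_inl_inl (v w : V₁) :
    (S₁.sum S₂).underlying.Adj (.inl v) (.inl w) ↔ S₁.underlying.Adj v w := by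
  simp [underlying]

@[simp] theorem sum_underlying_inr_inr (v w : V₂) :
    (S₁.sum S₂).underlying.Adj (.inr v) (.inr w) ↔ S₂.underlying.Adj v w := by
  simp [underlying]

@[simp] theorem sum_underlying_inl_inr (v : V₁) (w : V₂) :
    ¬ (S₁.sum S₂).underlying.Adj (.inl v) (.inr w) := by
  simp [underlying]

@[simp] theorem sum_underlying_inr_inl (v : V₂) (w : V₁) :
    ¬ (S₁.sum S₂).underlying.Adj (.inr v) (.inl w) := by
  simp [underlying]

theorem ncard_neighborSet_le_maxDegree [Finite V] (S : SemiGraph V E) (v : V) :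
    (S.underlying.neighborSet v).ncard ≤ S.maxDegree :=
  le_ciSup (f := fun v => (S.underlying.neighborSet v).ncard) (Set.finite_range _).bddAbove v

theorem maxDegree_le (S : SemiGraph V E) {k : ℕ}
    (h : ∀ v, (S.underlying.neighborSet v).ncard ≤ k) : S.maxDegree ≤ k := by
  rcases isEmpty_or_nonempty V with hV | hV
  · simp [maxDegree]
  · exact ciSup_le h

theorem ncard_neighborSet_sum_inl (v : V₁) :
    ((S₁.sum S₂).underlying.neighborSet (.inl v)).ncard = (S₁.underlying.neighborSet v).ncard := by
  rw [← Set.ncard_image_of_injective _ (Sum.inl_injective (α := V₁) (β := V₂))]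
  congr 1
  ext (w | w) <;> simp

theorem ncard_neighborSet_sum_inr (v : V₂) :
    ((S₁.sum S₂).underlying.neighborSet (.inr v)).ncard = (S₂.underlying.neighborSet v).ncard := by
  rw [← Set.ncard_image_of_injective _ (Sum.inr_injective (α := V₁) (β := V₂))]
  congr 1
  ext (w | w) <;> simp

theorem maxDegree_sum [Finite V₁] [Finite V₂] :
    (S₁.sum S₂).maxDegree = max S₁.maxDegree S₂.maxDegree := by
  refine le_antisymm (maxDegree_le _ ?_) (max_le (maxDegree_le _ fun v => ?_)
    (maxDegree_le _ fun v => ?_))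
  · rintro (v | v)
    · rw [ncard_neighborSet_sum_inl]
      exact le_max_of_le_left (ncard_neighborSet_le_maxDegree _ v)
    · rw [ncard_neighborSet_sum_inr]
      exact le_max_of_le_right (ncard_neighborSet_le_maxDegree _ v)
  · rw [← ncard_neighborSet_sum_inl S₁ S₂]
    exact ncard_neighborSet_le_maxDegree _ _
  · rw [← ncard_neighborSet_sum_inr S₁ S₂]
    exact ncard_neighborSet_le_maxDegree _ _

theorem exists_walk_sum_inl {v : V₁} {x : V₁ ⊕ V₂} (p : (S₁.sum S₂).underlying.Walk (.inl v) x) :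
    ∃ (u : V₁) (q : S₁.underlying.Walk v u), x = .inl u ∧ q.length = p.length := by
  generalize hy : (Sum.inl v : V₁ ⊕ V₂) = y at p
  induction p generalizing v with
  | nil => exact ⟨v, .nil, hy.symm, rfl⟩
  | @cons a b _ hab p ih =>
    subst hy
    rcases b with b | b
    · obtain ⟨u, q, hu, hq⟩ := ih rfl
      exact ⟨u, .cons ((sum_underlying_inl_inl S₁ S₂ v b).mp hab) q, hu, by
        rw [SimpleGraph.Walk.length_cons, SimpleGraph.Walk.length_cons, hq]⟩
    · exact absurd hab (sum_underlying_inl_inr S₁ S₂ v b)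

theorem exists_walk_inl_of_walk {v u : V₁} (p : S₁.underlying.Walk v u) :
    ∃ q : (S₁.sum S₂).underlying.Walk (.inl v) (.inl u), q.length = p.length := by
  induction p with
  | nil => exact ⟨.nil, rfl⟩
  | @cons a b _ hab p ih =>
    obtain ⟨q, hq⟩ := ih
    exact ⟨.cons ((sum_underlying_inl_inl S₁ S₂ a b).mpr hab) q, by
        rw [SimpleGraph.Walk.length_cons, SimpleGraph.Walk.length_cons, hq]⟩

theorem edist_sum_inl (v u : V₁) :
    (S₁.sum S₂).underlying.edist (.inl v) (.inl u) = S₁.underlying.edist v u := by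
  refine le_antisymm (le_iInf fun p => ?_) (le_iInf fun p => ?_)
  · obtain ⟨q, hq⟩ := exists_walk_inl_of_walk S₁ S₂ p
    rw [← hq]
    exact SimpleGraph.edist_le q
  · obtain ⟨u', q, hu, hq⟩ := exists_walk_sum_inl S₁ S₂ p
    obtain rfl := Sum.inl_injective hu
    rw [← hq]
    exact SimpleGraph.edist_le q

theorem edist_sum_inr (v : V₁) (u : V₂) :
    (S₁.sum S₂).underlying.edist (.inl v) (.inr u) = ⊤ := by
  by_contra h
  obtain ⟨p, -⟩ := SimpleGraph.exists_walk_of_edist_ne_top h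
  obtain ⟨_, _, hu, _⟩ := exists_walk_sum_inl S₁ S₂ p
  exact Sum.inr_ne_inl hu

end sum

theorem underlying_ofGraph (G : SimpleGraph V) : (ofGraph G).underlying = G := by
  ext v w
  constructor
  · rintro ⟨hne, ⟨e, he⟩, hv, hw⟩
    obtain rfl : e = s(v, w) := (Sym2.mem_and_mem_iff hne).mp ⟨hv, hw⟩
    exact he
  · exact fun h => ⟨h.ne, ⟨s(v, w), h⟩, Sym2.mem_mk_left v w, Sym2.mem_mk_right v w⟩

theorem underlying_restrictNodes_ofGraph (G : SimpleGraph V) (U : Set V) :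
    ((ofGraph G).restrictNodes U).underlying = G.restrictTo U := by
  ext v w
  constructor
  · rintro ⟨hne, ⟨e, he⟩, ⟨hv, hvU⟩, hw, hwU⟩
    obtain rfl : e = s(v, w) := (Sym2.mem_and_mem_iff hne).mp ⟨hv, hw⟩
    exact ⟨he, hvU, hwU⟩
  · rintro ⟨h, hv, hw⟩
    exact ⟨h.ne, ⟨s(v, w), h⟩, ⟨Sym2.mem_mk_left v w, hv⟩, Sym2.mem_mk_right v w, hw⟩

theorem maxDegree_restrictNodes_ofGraph_le (G : SimpleGraph V) {U : Set V} {k : ℕ}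
    (h : ∀ v ∈ U, G.degreeIn U v ≤ k) : ((ofGraph G).restrictNodes U).maxDegree ≤ k := by
  refine maxDegree_le _ fun v => ?_
  rw [underlying_restrictNodes_ofGraph]
  by_cases hv : v ∈ U
  · refine le_of_eq_of_le ?_ (h v hv)
    rw [SimpleGraph.degreeIn]
    congr 1
    ext w
    simp [SimpleGraph.restrictTo, hv]
  · rw [(Set.ncard_eq_zero (Set.Finite.subset Set.finite_empty ?_)).mpr ?_]
    · exact Nat.zero_le _
    · exact fun w hw => hv hw.2.1
    · exact Set.eq_empty_of_forall_notMem fun w hw => hv hw.2.1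

theorem maxDegree_ofGraph_top (k : ℕ) :
    (ofGraph (⊤ : SimpleGraph (Fin (k + 1)))).maxDegree = k := by
  have h : ∀ v : Fin (k + 1),
      ((ofGraph (⊤ : SimpleGraph (Fin (k + 1)))).underlying.neighborSet v).ncard = k := by
    intro v
    rw [underlying_ofGraph]
    have : (⊤ : SimpleGraph (Fin (k + 1))).neighborSet v = {v}ᶜ := by
      ext w
      simp [eq_comm]
    rw [this, Set.ncard_compl]
    simp
  simp [maxDegree, h]

end SemiGraph

/-! ### Identifiers, ports and views under restriction and disjoint union -/

namespace LocalInput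

variable {V E V₁ E₁ V₂ E₂ : Type} {c : ℕ}

theorem nonempty [Finite V] [Finite E] (S : SemiGraph V E) (hc : 1 ≤ c) :
    Nonempty (LocalInput S c) := by
  classical
  have hport : ∀ v, ∃ p : E → ℕ, Set.BijOn p {e | S.Inc v e} (Set.Iio (S.degree v)) := by
    intro v
    have hcard : Nat.card {e | S.Inc v e} = S.degree v := Nat.card_coe_set_eq _
    let φ : {e | S.Inc v e} ≃ Fin (S.degree v) := Finite.equivFinOfCardEq hcard
    refine ⟨fun e => if h : S.Inc v e then φ ⟨e, h⟩ else 0, ?_, ?_, ?_⟩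
    · intro e he
      have he' : S.Inc v e := he
      simp [he']
    · intro e he e' he' heq
      have he1 : S.Inc v e := he
      have he2 : S.Inc v e' := he'
      simp only [he1, he2, dite_true] at heq
      exact Subtype.ext_iff.mp (φ.injective (Fin.ext heq))
    · intro i hi
      have hinc : S.Inc v (φ.symm ⟨i, hi⟩).1 := (φ.symm ⟨i, hi⟩).2
      exact ⟨(φ.symm ⟨i, hi⟩).1, hinc, by simp [hinc]⟩
  choose port hport using hport
  let ψ := Finite.equivFin V
  exact ⟨⟨fun v => ψ v + 1, fun v w h => ψ.injective (Fin.ext (Nat.succ_injective h)),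
    fun v => ⟨Nat.succ_pos _, (ψ v).2.trans_le (Nat.le_self_pow (by omega) _)⟩, port, hport⟩⟩

/-- The identifiers and port numbers that remain after deleting half-edges. -/
def restrictNodes {S : SemiGraph V E} (I : LocalInput S c) (U : Set V) :
    LocalInput (S.restrictNodes U) c where
  ident := I.ident
  ident_injective := I.ident_injective
  ident_mem := I.ident_mem
  port := I.port
  port_bijOn v := by
    by_cases hv : v ∈ U
    · rw [S.degree_restrictNodes_of_mem hv]
      convert I.port_bijOn v using 1
      ext e
      simp [SemiGraph.restrictNodes, hv]
    · rw [S.degree_restrictNodes_of_notMem hv]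
      convert Set.bijOn_empty (I.port v) using 1
      · ext e
        simp [SemiGraph.restrictNodes, hv]
      · ext i
        simp

variable {S₁ : SemiGraph V₁ E₁} {S₂ : SemiGraph V₂ E₂}

/-- The symmetry-breaking data on a disjoint union, where the identifiers in the second part are
shifted beyond those of the first part. -/
noncomputable def sum [Finite V₁] [Finite V₂] (I₁ : LocalInput S₁ c) (I₂ : LocalInput S₂ c) (hc : 1 ≤ c) :
    LocalInput (S₁.sum S₂) c where
  ident := Sum.elim I₁.ident fun v => Nat.card V₁ ^ c + I₂.ident v
  ident_injective := by
    rintro (v | v) (w | w) h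
    · exact congrArg _ (I₁.ident_injective h)
    · have h1 := (I₁.ident_mem v).2
      have h2 := (I₂.ident_mem w).1
      simp only [Sum.elim_inl, Sum.elim_inr] at h
      omega
    · have h1 := (I₁.ident_mem w).2
      have h2 := (I₂.ident_mem v).1
      simp only [Sum.elim_inl, Sum.elim_inr] at h
      omega
    · exact congrArg _ (I₂.ident_injective (Nat.add_left_cancel h))
  ident_mem := by
    -- Superadditivity of the `c`-th power, valid as `c ≥ 1`, keeps the shifted identifiers in the
    -- allowed range.
    have hle : Nat.card V₁ ^ c + Nat.card V₂ ^ c ≤ Nat.card (V₁ ⊕ V₂) ^ c := by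
      rw [Nat.card_sum]
      exact pow_add_pow_le (Nat.zero_le _) (Nat.zero_le _) (by omega)
    rintro (v | v)
    · have := I₁.ident_mem v
      exact ⟨this.1, this.2.trans ((Nat.le_add_right _ _).trans hle)⟩
    · have := I₂.ident_mem v
      exact ⟨this.1.trans (Nat.le_add_left _ _), (Nat.add_le_add_left this.2 _).trans hle⟩
  port
    | .inl v, .inl e => I₁.port v e
    | .inr v, .inr e => I₂.port v e
    | _, _ => 0
  port_bijOn := by
    rintro (v | v)
    · rw [SemiGraph.setOf_sum_inc_inl, SemiGraph.sum_degree_inl,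
        ← Set.bijOn_comp_iff Sum.inl_injective.injOn]
      exact I₁.port_bijOn v
    · rw [SemiGraph.setOf_sum_inc_inr, SemiGraph.sum_degree_inr,
        ← Set.bijOn_comp_iff Sum.inr_injective.injOn]
      exact I₂.port_bijOn v

/-- The second part is at infinite distance, so nodes of the first part can act as if any padding
were present. -/
theorem view_sum_inl [Finite V₁] [Finite V₂] (I₁ : LocalInput S₁ c) (I₂ : LocalInput S₂ c)
    (hc : 1 ≤ c) (T : ℕ) (v : V₁) : (I₁.sum I₂ hc).view T (.inl v) = I₁.view T v := by
  refine LocalView.ext rfl ?_ ?_ ?_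
  · ext x
    constructor
    · rintro ⟨u | u, hu, rfl⟩
      · rw [SemiGraph.edist_sum_inl] at hu
        exact ⟨u, hu, by simp [sum]⟩
      · simp [SemiGraph.edist_sum_inr] at hu
    · rintro ⟨u, hu, rfl⟩
      exact ⟨.inl u, by rwa [SemiGraph.edist_sum_inl], by simp [sum]⟩
  · ext x
    constructor
    · rintro ⟨u | u, e | e, hu, hue, rfl⟩
      · rw [SemiGraph.edist_sum_inl] at hu
        exact ⟨u, e, hu, hue, by simp [sum]⟩
      · exact hue.elim
      · exact hue.elim
      · simp [SemiGraph.edist_sum_inr] at hu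
    · rintro ⟨u, e, hu, hue, rfl⟩
      exact ⟨.inl u, .inl e, by rwa [SemiGraph.edist_sum_inl], hue, by simp [sum]⟩
  · ext x
    constructor
    · rintro ⟨u | u, w | w, e | e, hu, huw, hue, hwe, rfl⟩
      · rw [SemiGraph.edist_sum_inl] at hu
        exact ⟨u, w, e, hu, fun h => huw (congrArg _ h), hue, hwe, by simp [sum]⟩
      · exact hue.elim
      · exact hwe.elim
      · exact hue.elim
      · exact hue.elim
      · exact hwe.elim
      · exact hue.elim
      · simp [SemiGraph.edist_sum_inr] at hu
    · rintro ⟨u, w, e, hu, huw, hue, hwe, rfl⟩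
      exact ⟨.inl u, .inl w, .inl e, by rwa [SemiGraph.edist_sum_inl],
        fun h => huw (Sum.inl_injective h), hue, hwe, by simp [sum]⟩

end LocalInput

/-! ### Label multisets at nodes and edges -/

/-- The half-edge labeling given by a rule that labels the ports of every node. -/
def LocalInput.labeling {V E : Type} {L : Type*} {c : ℕ} {S : SemiGraph V E} (I : LocalInput S c) (F : V → ℕ → L)
    (x : S.HalfEdge) : L :=
  F x.1.1 (I.port x.1.1 x.1.2)

namespace SemiGraph

theorem rank_le {V E : Type} [Finite V] (S : SemiGraph V E) (e : E) : S.rank e ≤ 2 := by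
  have := S.rank_le_two e
  rw [← Set.Finite.cast_ncard_eq (Set.toFinite _)] at this
  exact_mod_cast this

theorem rank_ofGraph {V : Type} {G : SimpleGraph V} (e : G.edgeSet) : (ofGraph G).rank e = 2 := by
  obtain ⟨e, he⟩ := e
  induction e using Sym2.ind with
  | _ a b =>
    have h : {v | v ∈ s(a, b)} = ({a, b} : Set V) := by
      ext v
      simp
    change {v | v ∈ s(a, b)}.ncard = 2
    rw [h, Set.ncard_pair (G.ne_of_adj he)]

variable {V E V₁ E₁ : Type} [Finite V] [Finite E] [Finite V₁] [Finite E₁] {L : Type*} {c : ℕ}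

/-- Ports biject with the half-edges at `v`, so the node constraint depends only on the port rule
and the degree, not on the ambient semi-graph. -/
theorem nodeLabels_labeling {S : SemiGraph V E} (I : LocalInput S c) (F : V → ℕ → L) (v : V) :
    S.nodeLabels (LocalInput.labeling I F) v = (Multiset.range (S.degree v)).map (F v) := by
  classical
  set s := (Set.toFinite {x : S.HalfEdge | x.1.1 = v}).toFinset with hs
  have hmem : ∀ x, x ∈ s ↔ x.1.1 = v := fun x => by simp [hs]
  have hinj : Set.InjOn (fun x : S.HalfEdge => I.port v x.1.2) s := by
    rintro ⟨⟨a, e⟩, hx⟩ hxs ⟨⟨b, e'⟩, hy⟩ hys heq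
    obtain rfl : a = v := (hmem _).mp hxs
    obtain rfl : b = a := (hmem _).mp hys
    have : e = e' := (I.port_bijOn b).injOn hx hy heq
    subst this
    rfl
  have himg : s.image (fun x : S.HalfEdge => I.port v x.1.2) = Finset.range (S.degree v) := by
    ext i
    simp only [Finset.mem_image, Finset.mem_range]
    constructor
    · rintro ⟨⟨⟨a, e⟩, hx⟩, hxs, rfl⟩
      obtain rfl : a = v := (hmem _).mp hxs
      exact (I.port_bijOn a).mapsTo hx
    · intro hi
      obtain ⟨e, he, rfl⟩ := (I.port_bijOn v).surjOn hi
      exact ⟨⟨(v, e), he⟩, (hmem _).mpr rfl, rfl⟩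
  calc S.nodeLabels (LocalInput.labeling I F) v = s.val.map (LocalInput.labeling I F) := rfl
    _ = s.val.map (F v ∘ fun x : S.HalfEdge => I.port v x.1.2) := by
      refine Multiset.map_congr rfl fun x hx => ?_
      obtain rfl : x.1.1 = v := (hmem x).mp hx
      rfl
    _ = (s.val.map fun x : S.HalfEdge => I.port v x.1.2).map (F v) := (Multiset.map_map _ _ _).symm
    _ = _ := by rw [← Finset.image_val_of_injOn hinj, himg]; rfl

theorem edgeLabels_eq_of_image {S₁ : SemiGraph V₁ E₁} {X : Type*} (φ : S₁.HalfEdge → X)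
    (hφ : Function.Injective φ) (h : X → L) (e : E₁) (s : Finset X)
    (hs : ∀ y, y ∈ s ↔ ∃ x, x.1.2 = e ∧ φ x = y) :
    S₁.edgeLabels (fun x => h (φ x)) e = s.val.map h := by
  classical
  have : s = (Set.toFinite {x : S₁.HalfEdge | x.1.2 = e}).toFinset.map ⟨φ, hφ⟩ := by
    ext y
    simp [hs]
  rw [this, Finset.map_val, Multiset.map_map]
  rfl

/-- The half-edges at `e` split according to whether their node lies in `U`; this matches the sum `χ
+ ψ` in the residual edge lists. -/
theorem edgeLabels_restrictNodes_add (S : SemiGraph V E) (U : Set V) (h : S.HalfEdge → L) (e : E) :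
    (S.restrictNodes Uᶜ).edgeLabels (fun x => h ⟨x.1, x.2.1⟩) e +
      (S.restrictNodes U).edgeLabels (fun x => h ⟨x.1, x.2.1⟩) e = S.edgeLabels h e := by
  classical
  set s := (Set.toFinite {x : S.HalfEdge | x.1.2 = e}).toFinset with hs
  have key : ∀ (W : Set V) [DecidablePred (· ∈ W)], (S.restrictNodes W).edgeLabels (fun x => h ⟨x.1, x.2.1⟩) e =
      (s.filter fun x => x.1.1 ∈ W).val.map h := by
    intro W _
    refine edgeLabels_eq_of_image (S₁ := S.restrictNodes W) (fun x => (⟨x.1, x.2.1⟩ : S.HalfEdge))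
      (fun x y hxy => Subtype.ext (congrArg (fun z : S.HalfEdge => z.1) hxy)) h e _ fun y => ?_
    simp only [Finset.mem_filter, hs, Set.Finite.mem_toFinset, Set.mem_ofPred_eq]
    constructor
    · exact fun hy => ⟨⟨y.1, y.2, hy.2⟩, hy.1, rfl⟩
    · rintro ⟨x, hx, rfl⟩
      exact ⟨hx, x.2.2⟩
  rw [key, key, ← Multiset.map_add, add_comm]
  refine congrArg (Multiset.map h) (Eq.trans ?_
    (Multiset.filter_add_not (fun x : S.HalfEdge => x.1.1 ∈ U) s.val))
  exact congrArg _ (Multiset.filter_congr fun x _ => Iff.rfl)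

theorem edgeLabels_sum_inl {V₂ E₂ : Type} [Finite V₂] [Finite E₂] (S₁ : SemiGraph V₁ E₁)
    (S₂ : SemiGraph V₂ E₂) (h : (S₁.sum S₂).HalfEdge → L) (e : E₁) :
    (S₁.sum S₂).edgeLabels h (.inl e) =
      S₁.edgeLabels (fun x => h ⟨(.inl x.1.1, .inl x.1.2), x.2⟩) e := by
  refine (edgeLabels_eq_of_image (S₁ := S₁)
    (fun x => (⟨(.inl x.1.1, .inl x.1.2), x.2⟩ : (S₁.sum S₂).HalfEdge)) ?_ h e
    (Set.toFinite {x : (S₁.sum S₂).HalfEdge | x.1.2 = .inl e}).toFinset fun y => ?_).symm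
  · intro x y hxy
    have := Subtype.ext_iff.mp hxy
    simp only [Prod.mk.injEq, Sum.inl.injEq] at this
    exact Subtype.ext (Prod.ext this.1 this.2)
  · simp only [Set.Finite.mem_toFinset, Set.mem_ofPred_eq]
    constructor
    · obtain ⟨⟨v | v, e'⟩, hy⟩ := y
      · rintro rfl
        exact ⟨⟨(v, e), hy⟩, rfl, rfl⟩
      · rintro rfl
        exact hy.elim
    · rintro ⟨x, rfl, rfl⟩
      rfl

theorem edgeLabels_ofGraph {G : SimpleGraph V} {u w : V} (huw : G.Adj u w)
    (h : (ofGraph G).HalfEdge → L) : (ofGraph G).edgeLabels h ⟨s(u, w), huw⟩ =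
      {h ⟨(u, ⟨s(u, w), huw⟩), Sym2.mem_mk_left u w⟩,
        h ⟨(w, ⟨s(u, w), huw⟩), Sym2.mem_mk_right u w⟩} := by
  classical
  set a : (ofGraph G).HalfEdge := ⟨(u, ⟨s(u, w), huw⟩), Sym2.mem_mk_left u w⟩ with ha
  set b : (ofGraph G).HalfEdge := ⟨(w, ⟨s(u, w), huw⟩), Sym2.mem_mk_right u w⟩ with hb
  have hab : a ≠ b := fun h => huw.ne (congrArg (fun x => x.1.1) h)
  refine (edgeLabels_eq_of_image (S₁ := ofGraph G) id Function.injective_id h _ {a, b} ?_).trans ?_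
  rotate_left
  · rw [Finset.insert_val_of_notMem (by simpa using hab)]
    simp
  · intro y
    simp only [Finset.mem_insert, Finset.mem_singleton, id]
    constructor
    · rintro (rfl | rfl) <;> exact ⟨_, rfl, rfl⟩
    · rintro ⟨⟨⟨v, e⟩, hv⟩, rfl, rfl⟩
      rcases Sym2.mem_iff.mp (show v ∈ s(u, w) from hv) with rfl | rfl
      · exact Or.inl rfl
      · exact Or.inr rfl

end SemiGraph

/-! ### Completing a partial solution through the edge-list variant -/

namespace NodeEdgeProblem

variable {L : Type*} (P : NodeEdgeProblem L) {V E : Type} [Finite V] [Finite E] {c : ℕ}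

open Classical in
/-- A solution on the part of a semi-graph that is spanned by a set `U` of nodes can be completed if
the edge-list variant is always solvable. -/
theorem EdgeListAlwaysSolvable.exists_completion [Nonempty L] (hP : P.EdgeListAlwaysSolvable)
    {S : SemiGraph V E} (I : LocalInput S c) (U : Set V) (F : V → ℕ → L)
    (hF : P.IsSolution (S.restrictNodes U) (LocalInput.labeling (I.restrictNodes U) F)) :
    ∃ Φ : ℕ → ℕ → L, P.IsSolution S
      (LocalInput.labeling I fun v => if v ∈ U then F v else Φ (I.ident v)) := by
  let ψ : E → Multiset L :=
    (S.restrictNodes U).edgeLabels (LocalInput.labeling (I.restrictNodes U) F)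
  have hψ : ∀ e, ψ e ∈ P.edge ((S.restrictNodes U).rank e) := hF.2
  have hcard : ∀ e, (ψ e).card = (S.restrictNodes U).rank e := fun e => (P.card_edge _ _ (hψ e)).1
  -- The list of an edge is the residual of the labels already placed on it, possibly none; the two
  -- ranks add up to the original rank, at most 2.
  obtain ⟨h, hnode, hedge⟩ := hP V E (S.restrictNodes Uᶜ)
    (fun e => P.edgeResidual ((S.restrictNodes Uᶜ).rank e) (ψ e)) fun e =>
      ⟨(S.restrictNodes U).rank e, by rw [S.rank_restrictNodes_add]; exact S.rank_le e,
        ψ e, hψ e, rfl⟩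
  -- Indexing the completion by identifier and port frees it from the node type, so that nodes can
  -- choose it from local data.
  let key : (S.restrictNodes Uᶜ).HalfEdge → ℕ × ℕ := fun x => (I.ident x.1.1, I.port x.1.1 x.1.2)
  have hkey : Function.Injective key := by
    rintro ⟨⟨v, e⟩, hx⟩ ⟨⟨w, e'⟩, hy⟩ heq
    simp only [key, Prod.mk.injEq] at heq
    obtain rfl := I.ident_injective heq.1
    obtain rfl := (I.port_bijOn v).injOn hx.1 hy.1 heq.2
    rfl
  let Ψ : ℕ × ℕ → L := Function.extend key h fun _ => Classical.arbitrary L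
  let F' : V → ℕ → L := fun v => if v ∈ U then F v else fun p => Ψ (I.ident v, p)
  have hh : h = LocalInput.labeling (I.restrictNodes Uᶜ) F' := by
    funext x
    have hx : x.1.1 ∉ U := x.2.2
    simp only [LocalInput.labeling, F', if_neg hx]
    exact (hkey.extend_apply h _ x).symm
  have hFF : LocalInput.labeling (I.restrictNodes U) F =
      LocalInput.labeling (I.restrictNodes U) F' := by
    funext x
    have hx : x.1.1 ∈ U := x.2.2
    simp only [LocalInput.labeling, F', if_pos hx]
  refine ⟨fun i p => Ψ (i, p), fun v => ?_, fun e => ?_⟩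
  · rw [SemiGraph.nodeLabels_labeling I F']
    by_cases hv : v ∈ U
    · have := hF.1 v
      rwa [hFF, SemiGraph.nodeLabels_labeling, S.degree_restrictNodes_of_mem hv] at this
    · have := hnode v
      rwa [hh, SemiGraph.nodeLabels_labeling, S.degree_restrictNodes_of_mem hv] at this
  · have := (hedge e).2
    rw [hcard, S.rank_restrictNodes_add, hh] at this
    rw [← S.edgeLabels_restrictNodes_add U]
    have hψF : ψ e = _ := congrArg (fun y => (S.restrictNodes U).edgeLabels y e) hFF
    rw [hψF] at this
    exact this

end NodeEdgeProblem

/-! ### Simulating views in a restricted part of the tree -/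

namespace TreeInput

variable {n c : ℕ}

theorem exists_inc_iff (D : TreeInput n c) (v : D.V) (p : D.G.edgeSet → Prop) :
    (∃ e, (SemiGraph.ofGraph D.G).Inc v e ∧ p e) ↔
      ∃ (w : D.V) (h : D.G.Adj v w), p ⟨s(v, w), h⟩ := by
  constructor
  · rintro ⟨⟨e, he⟩, hv, hp⟩
    obtain ⟨w, rfl⟩ := Sym2.mem_iff_exists.mp hv
    exact ⟨w, he, hp⟩
  · rintro ⟨w, h, hp⟩
    exact ⟨_, D.inc_left h, hp⟩

open Classical in
theorem rank_restrictNodes (D : TreeInput n c) {U : Set D.V} {v w : D.V} (h : D.G.Adj v w)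
    (hv : v ∈ U) :
    ((SemiGraph.ofGraph D.G).restrictNodes U).rank ⟨s(v, w), h⟩ = if w ∈ U then 2 else 1 := by
  have hset : {x | ((SemiGraph.ofGraph D.G).restrictNodes U).Inc x ⟨s(v, w), h⟩} =
      {x | (x = v ∨ x = w) ∧ x ∈ U} := by
    ext x
    exact and_congr_left fun _ => Sym2.mem_iff
  rw [SemiGraph.rank, hset]
  split_ifs with hw
  · rw [← Set.ncard_pair h.ne]
    congr 1
    ext x
    simp only [Set.mem_ofPred_eq, Set.mem_insert_iff, Set.mem_singleton_iff, and_iff_left_iff_imp]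
    rintro (rfl | rfl) <;> assumption
  · rw [← Set.ncard_singleton v]
    congr 1
    ext x
    simp only [Set.mem_ofPred_eq, Set.mem_singleton_iff]
    constructor
    · rintro ⟨rfl | rfl, hx⟩
      · rfl
      · exact absurd hx hw
    · rintro rfl
      exact ⟨Or.inl rfl, hv⟩

namespace IsLocal

variable {α : Type*} {T : ℕ} {U : (D : TreeInput n c) → Set D.V}

open Classical in
theorem degree_restrictNodes (hU : IsLocal T fun D v => v ∈ U D) :
    IsLocal T fun D v => ((SemiGraph.ofGraph D.G).restrictNodes (U D)).degree v := by
  have h := (hU.prodMk (degree.mono (Nat.zero_le T))).comp fun x => if x.1 then x.2 else 0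
  convert h using 3 with D v
  by_cases hv : v ∈ U D
  · simp [hv, SemiGraph.degree_restrictNodes_of_mem]
  · simp [hv, SemiGraph.degree_restrictNodes_of_notMem]

open Classical in
-- The extra round tells whether the other endpoint lies in `U`, which decides between rank 2 and
-- rank 1.
theorem ends_restrictNodes (hU : IsLocal T fun D v => v ∈ U D) :
    IsLocal (T + 1) fun D v => {x : ℕ × ℕ × ℕ | ∃ e,
      ((SemiGraph.ofGraph D.G).restrictNodes (U D)).Inc v e ∧ x = (D.I.ident v, D.I.port v e,
        ((SemiGraph.ofGraph D.G).restrictNodes (U D)).rank e)} := by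
  have h := ((hU.mono (Nat.le_succ T)).prodMk ((ident.mono (Nat.zero_le _)).prodMk
    hU.neighbors)).comp fun y => {x : ℕ × ℕ × ℕ | y.1 ∧ ∃ z ∈ y.2.2,
      x = (y.2.1, z.1, if z.2.2 then 2 else 1)}
  convert h using 3 with D v
  ext x
  by_cases hv : v ∈ U D
  · simp only [SemiGraph.restrictNodes, hv, and_true, Set.mem_ofPred_eq, true_and]
    rw [D.exists_inc_iff]
    constructor
    · rintro ⟨w, hw, rfl⟩
      refine ⟨_, ⟨w, hw, rfl⟩, ?_⟩
      rw [D.portTo_eq hw]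
      exact congrArg (fun r => (D.I.ident v, D.I.port v ⟨s(v, w), hw⟩, r))
        (D.rank_restrictNodes hw hv)
    · rintro ⟨_, ⟨w, hw, rfl⟩, rfl⟩
      refine ⟨w, hw, ?_⟩
      rw [D.portTo_eq hw]
      exact congrArg (fun r => (D.I.ident v, D.I.port v ⟨s(v, w), hw⟩, r))
        (D.rank_restrictNodes hw hv).symm
  · simp [SemiGraph.restrictNodes, hv]

theorem links_restrictNodes (hU : IsLocal T fun D v => v ∈ U D) :
    IsLocal (T + 1) fun D v => {x : ℕ × ℕ × ℕ × ℕ | ∃ w e, v ≠ w ∧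
      ((SemiGraph.ofGraph D.G).restrictNodes (U D)).Inc v e ∧
      ((SemiGraph.ofGraph D.G).restrictNodes (U D)).Inc w e ∧
      x = (D.I.ident v, D.I.port v e, D.I.ident w, D.I.port w e)} := by
  have h := ((hU.mono (Nat.le_succ T)).prodMk ((ident.mono (Nat.zero_le _)).prodMk
    (hU.prodMk (ident.mono (Nat.zero_le _))).neighbors)).comp fun y =>
      {x : ℕ × ℕ × ℕ × ℕ | y.1 ∧ ∃ z ∈ y.2.2, z.2.2.1 ∧ x = (y.2.1, z.1, z.2.2.2, z.2.1)}
  convert h using 3 with D v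
  ext x
  constructor
  · rintro ⟨w, ⟨e, he⟩, hne, ⟨hv, hvU⟩, ⟨hw, hwU⟩, rfl⟩
    obtain rfl : e = s(v, w) := (Sym2.mem_and_mem_iff hne).mp ⟨hv, hw⟩
    have hadj : D.G.Adj v w := he
    refine ⟨hvU, _, ⟨w, hadj, rfl⟩, hwU, ?_⟩
    rw [D.portTo_eq hadj, D.portTo_eq' hadj]
  · rintro ⟨hvU, _, ⟨w, hadj, rfl⟩, hwU, rfl⟩
    refine ⟨w, ⟨s(v, w), hadj⟩, hadj.ne, ⟨D.inc_left hadj, hvU⟩, ⟨D.inc_right hadj, hwU⟩, ?_⟩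
    rw [D.portTo_eq hadj, D.portTo_eq' hadj]

/-- The view in the part of the tree that is spanned by a locally recognizable set of nodes can be
simulated. -/
theorem view_restrictNodes (hU : IsLocal T fun D v => v ∈ U D) (R : ℕ) :
    IsLocal (T + 1 + R) fun D v => (D.I.restrictNodes (U D)).view R v := by
  have hU' : IsLocal (T + 1) fun D v => v ∈ U D := hU.mono (Nat.le_succ T)
  intro D D' v v' hv
  have hun : ∀ D : TreeInput n c, ((SemiGraph.ofGraph D.G).restrictNodes (U D)).underlying =
      D.G.restrictTo (U D) := fun D => SemiGraph.underlying_restrictNodes_ofGraph _ _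
  refine LocalView.ext (LocalInput.ident_eq_of_view_eq hv) ?_ ?_ ?_
  · have h := IsLocal.ball (j := R) hU' ((ident.mono (Nat.zero_le _)).prodMk
      (hU.degree_restrictNodes.mono (Nat.le_succ T))) D D' v v' hv
    simp only [LocalInput.view, hun]
    exact h
  · have h := (IsLocal.ball (j := R) hU' hU.ends_restrictNodes).comp Set.sUnion D D' v v' hv
    have key : ∀ (D : TreeInput n c) (v : D.V), ((D.I.restrictNodes (U D)).view R v).ends =
        Set.sUnion {x | ∃ u, (D.G.restrictTo (U D)).edist v u ≤ R ∧ x =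
          {x : ℕ × ℕ × ℕ | ∃ e, ((SemiGraph.ofGraph D.G).restrictNodes (U D)).Inc u e ∧
            x = (D.I.ident u, D.I.port u e,
              ((SemiGraph.ofGraph D.G).restrictNodes (U D)).rank e)}} := by
      intro D v
      ext x
      simp only [LocalInput.view, hun]
      constructor
      · rintro ⟨u, e, hu, he, rfl⟩
        exact ⟨_, ⟨u, hu, rfl⟩, e, he, rfl⟩
      · rintro ⟨_, ⟨u, hu, rfl⟩, e, he, rfl⟩
        exact ⟨u, e, hu, he, rfl⟩
    rw [key, key]
    exact h
  -- Links are recorded only at distance strictly below the radius: none for radius 0, and those at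
  -- the ball of radius `R` for radius `R + 1`.
  · cases R with
    | zero =>
      simp [LocalInput.view]
    | succ R =>
      have h := ((IsLocal.ball (j := R) hU' hU.links_restrictNodes).mono
        (T' := T + 1 + (R + 1)) (by omega)).comp Set.sUnion D D' v v' hv
      have key : ∀ (D : TreeInput n c) (v : D.V),
          ((D.I.restrictNodes (U D)).view (R + 1) v).links =
          Set.sUnion {x | ∃ u, (D.G.restrictTo (U D)).edist v u ≤ R ∧ x =
            {x : ℕ × ℕ × ℕ × ℕ | ∃ w e, u ≠ w ∧
              ((SemiGraph.ofGraph D.G).restrictNodes (U D)).Inc u e ∧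
              ((SemiGraph.ofGraph D.G).restrictNodes (U D)).Inc w e ∧
              x = (D.I.ident u, D.I.port u e, D.I.ident w, D.I.port w e)}} := by
        intro D v
        ext x
        simp only [LocalInput.view, hun]
        have hlt : ∀ u, (D.G.restrictTo (U D)).edist v u < (R + 1 : ℕ) ↔
            (D.G.restrictTo (U D)).edist v u ≤ R := fun u => by
          push_cast
          exact ENat.lt_add_one_iff (ENat.natCast_ne_top R)
        constructor
        · rintro ⟨u, w, e, hu, hne, hue, hwe, rfl⟩
          exact ⟨_, ⟨u, (hlt u).mp hu, rfl⟩, w, e, hne, hue, hwe, rfl⟩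
        · rintro ⟨_, ⟨u, hu, rfl⟩, w, e, hne, hue, hwe, rfl⟩
          exact ⟨u, w, e, (hlt u).mpr hu, hne, hue, hwe, rfl⟩
      rw [key, key]
      exact h

end IsLocal

end TreeInput

/-! ### The algorithm on trees for a fixed degree threshold -/

namespace NodeEdgeProblem

variable {L : Type*} (P : NodeEdgeProblem L) {n c : ℕ}

/-- The constraints at a node outside of the precomputed part, for a labeling `Φ` of the ports of
the nodes, given by their identifiers: `x` consists of the identifier of the node, its degree, and,
for each neighbour, the two ports, the identifier and the precomputed labels of the neighbour. -/
def SatisfiesAt (Φ : ℕ → ℕ → L) (x : ℕ × ℕ × Set (ℕ × ℕ × ℕ × Option (ℕ → L))) : Prop :=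
  (Multiset.range x.2.1).map (Φ x.1) ∈ P.node x.2.1 ∧
    ∀ y ∈ x.2.2, ({Φ x.1 y.1, y.2.2.2.getD (Φ y.2.2.1) y.2.1} : Multiset L) ∈ P.edge 2

open Classical in
/-- If partial solutions on locally recognizable sets can be completed and the components of the
remaining nodes have bounded diameter, then they can be completed by a local rule. -/
theorem exists_isLocal_completion [Nonempty L] {T j : ℕ} {U : (D : TreeInput n c) → Set D.V}
    {F : (D : TreeInput n c) → D.V → ℕ → L} (hU : TreeInput.IsLocal T fun D v => v ∈ U D)
    (hF : TreeInput.IsLocal T F)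
    (hdiam : ∀ (D : TreeInput n c) (v u : D.V), (D.G.restrictTo (U D)ᶜ).Reachable v u →
      (D.G.restrictTo (U D)ᶜ).edist v u ≤ j)
    (hcomp : ∀ D : TreeInput n c, ∃ Φ : ℕ → ℕ → L, P.IsSolution (SemiGraph.ofGraph D.G)
      (LocalInput.labeling D.I fun v => if v ∈ U D then F D v else Φ (D.I.ident v))) :
    ∃ F' : (D : TreeInput n c) → D.V → ℕ → L, TreeInput.IsLocal (T + 1 + j) F' ∧
      ∀ D : TreeInput n c, P.IsSolution (SemiGraph.ofGraph D.G)
        (LocalInput.labeling D.I (F' D)) := by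
  let lab : (D : TreeInput n c) → D.V → Option (ℕ → L) := fun D v =>
    if v ∈ U D then some (F D v) else none
  have hlab : TreeInput.IsLocal T lab :=
    (hU.prodMk hF).comp fun x => if x.1 then some x.2 else none
  let info : (D : TreeInput n c) → D.V → ℕ × ℕ × Set (ℕ × ℕ × ℕ × Option (ℕ → L)) := fun D v =>
    (D.I.ident v, (SemiGraph.ofGraph D.G).degree v,
      {x | ∃ w, D.G.Adj v w ∧ x = (D.portTo v w, D.portTo w v, D.I.ident w, lab D w)})
  have hinfo : TreeInput.IsLocal (T + 1) info :=
    (TreeInput.IsLocal.ident.mono (Nat.zero_le _)).prodMk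
      ((TreeInput.IsLocal.degree.mono (Nat.zero_le _)).prodMk
        ((TreeInput.IsLocal.ident.mono (Nat.zero_le _)).prodMk hlab).neighbors)
  let nearby : (D : TreeInput n c) → D.V → Set (ℕ × ℕ × Set (ℕ × ℕ × ℕ × Option (ℕ → L))) :=
    fun D v => {x | ∃ u, (D.G.restrictTo (U D)ᶜ).edist v u ≤ j ∧ x = info D u}
  have hnearby : TreeInput.IsLocal (T + 1 + j) nearby :=
    TreeInput.IsLocal.ball (U := fun D => (U D)ᶜ) (hU.mem_not.mono (Nat.le_succ T)) hinfo
  -- One rule, fixed in advance, maps a set of constraints to a labeling satisfying all of them, if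
  -- there is one.
  have hsel : ∀ s : Set (ℕ × ℕ × Set (ℕ × ℕ × ℕ × Option (ℕ → L))), ∃ Φ : ℕ → ℕ → L,
      (∃ Φ : ℕ → ℕ → L, ∀ x ∈ s, P.SatisfiesAt Φ x) → ∀ x ∈ s, P.SatisfiesAt Φ x := by
    intro s
    by_cases h : ∃ Φ : ℕ → ℕ → L, ∀ x ∈ s, P.SatisfiesAt Φ x
    · exact ⟨h.choose, fun _ => h.choose_spec⟩
    · exact ⟨Classical.arbitrary _, fun h' => absurd h' h⟩
  choose sel hsel using hsel
  let F' : (D : TreeInput n c) → D.V → ℕ → L := fun D v =>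
    if v ∈ U D then F D v else sel (nearby D v) (D.I.ident v)
  refine ⟨F', ?_, fun D => ?_⟩
  · exact ((hU.mono (by omega)).prodMk ((hF.mono (by omega)).prodMk (hnearby.prodMk
      (TreeInput.IsLocal.ident.mono (Nat.zero_le _))))).comp fun x =>
        if x.1 then x.2.1 else sel x.2.2.1 x.2.2.2
  obtain ⟨Φ, hΦ⟩ := hcomp D
  set F₀ : D.V → ℕ → L := fun v => if v ∈ U D then F D v else Φ (D.I.ident v) with hF₀
  have hnode : ∀ v, (Multiset.range ((SemiGraph.ofGraph D.G).degree v)).map (F₀ v) ∈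
      P.node ((SemiGraph.ofGraph D.G).degree v) := fun v => by
    rw [← SemiGraph.nodeLabels_labeling D.I]
    exact hΦ.1 v
  have edgeLab : ∀ (H : D.V → ℕ → L) (v w : D.V) (h : D.G.Adj v w),
      (SemiGraph.ofGraph D.G).edgeLabels (LocalInput.labeling D.I H) ⟨s(v, w), h⟩ =
        {H v (D.portTo v w), H w (D.portTo w v)} := by
    intro H v w h
    rw [D.portTo_eq h, D.portTo_eq' h]
    exact SemiGraph.edgeLabels_ofGraph h _
  have hedge : ∀ v w, D.G.Adj v w →
      ({F₀ v (D.portTo v w), F₀ w (D.portTo w v)} : Multiset L) ∈ P.edge 2 := by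
    intro v w h
    have := hΦ.2 ⟨s(v, w), h⟩
    rwa [edgeLab, SemiGraph.rank_ofGraph] at this
  -- The global completion `Φ` witnesses that the constraints of the component are satisfiable.
  have hgood : ∀ v, v ∉ U D → ∀ x ∈ nearby D v, P.SatisfiesAt (sel (nearby D v)) x := by
    intro v hv
    refine hsel _ ⟨Φ, ?_⟩
    rintro _ ⟨u, hu, rfl⟩
    have huU : u ∉ U D := by
      obtain ⟨p, -⟩ := SimpleGraph.exists_walk_length_le_of_edist_le hu
      cases p.reverse with
      | nil => exact hv
      | cons h _ => exact h.2.1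
    refine ⟨?_, ?_⟩
    · have := hnode u
      simp only [hF₀, if_neg huU] at this
      exact this
    · rintro _ ⟨w, hw, rfl⟩
      have := hedge u w hw
      simp only [hF₀, if_neg huU] at this
      by_cases hwU : w ∈ U D
      · simpa [lab, hwU] using this
      · simpa [lab, hwU] using this
  have hself : ∀ v, v ∉ U D → P.SatisfiesAt (sel (nearby D v)) (info D v) := fun v hv =>
    hgood v hv _ ⟨v, by simp, rfl⟩
  have hUF : ∀ v, v ∈ U D → F' D v = F₀ v := fun v hv => by simp [F', hF₀, hv]
  have hUnF : ∀ v, v ∉ U D → F' D v = sel (nearby D v) (D.I.ident v) := fun v hv => by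
    simp [F', hv]
  have hedge' : ∀ v w, D.G.Adj v w → v ∉ U D →
      ({F' D v (D.portTo v w), F' D w (D.portTo w v)} : Multiset L) ∈ P.edge 2 := by
    intro v w h hv
    have := (hself v hv).2 _ ⟨w, h, rfl⟩
    by_cases hw : w ∈ U D
    · simpa [F', info, lab, hv, hw] using this
    · have hreach : (D.G.restrictTo (U D)ᶜ).Reachable v w := SimpleGraph.Adj.reachable ⟨h, hv, hw⟩
      -- By the diameter bound, both balls are the whole common component, so both endpoints choose
      -- the same labeling.
      have heq : nearby D v = nearby D w := by
        ext x
        constructor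
        · rintro ⟨u, hu, rfl⟩
          obtain ⟨p, -⟩ := SimpleGraph.exists_walk_length_le_of_edist_le hu
          exact ⟨u, hdiam D w u (hreach.symm.trans p.reachable), rfl⟩
        · rintro ⟨u, hu, rfl⟩
          obtain ⟨p, -⟩ := SimpleGraph.exists_walk_length_le_of_edist_le hu
          exact ⟨u, hdiam D v u (hreach.trans p.reachable), rfl⟩
      rw [hUnF v hv, hUnF w hw, ← heq]
      simpa [info, lab, hw] using this
  refine ⟨fun v => ?_, fun ⟨e, he⟩ => ?_⟩
  · rw [SemiGraph.nodeLabels_labeling]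
    by_cases hv : v ∈ U D
    · rw [hUF v hv]
      exact hnode v
    · rw [hUnF v hv]
      exact (hself v hv).1
  · induction e using Sym2.ind with
    | _ v w =>
      have h : D.G.Adj v w := he
      rw [SemiGraph.rank_ofGraph, edgeLab (F' D) v w h]
      by_cases hv : v ∈ U D
      · by_cases hw : w ∈ U D
        · rw [hUF v hv, hUF w hw]
          exact hedge v w h
        · rw [Multiset.pair_comm]
          exact hedge' w v h.symm hw
      · exact hedge' v w h hv

/-- An algorithm for semi-graphs of degree `k` solves the problem on every part of degree at most
`k`, after padding with a disjoint complete graph. -/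
theorem isSolution_restrictNodes (hc : 1 ≤ c) (A : LocalAlgorithm L)
    (hA : ∀ (V E : Type) [Finite V] [Finite E] (S : SemiGraph V E) (I : LocalInput S c),
      P.IsSolution S (A.run I)) {V E : Type} [Finite V] [Finite E] {S : SemiGraph V E} {k : ℕ}
    (hS : S.maxDegree ≤ k) (I : LocalInput S c) :
    P.IsSolution S (LocalInput.labeling I fun v => A.out (Nat.card V + (k + 1)) k
      (I.view (A.rounds (Nat.card V + (k + 1)) k) v)) := by
  -- The actual degree of the part is a global quantity. A disjoint complete graph on `k + 1` nodes
  -- makes the maximum degree exactly `k` and the number of nodes `Nat.card V + (k + 1)`, so both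
  -- parameters of `A` are known.
  obtain ⟨J⟩ := LocalInput.nonempty (SemiGraph.ofGraph (⊤ : SimpleGraph (Fin (k + 1)))) hc
  have h := hA _ _ _ (I.sum J hc)
  have hcard : Nat.card (V ⊕ Fin (k + 1)) = Nat.card V + (k + 1) := by simp
  have hdeg : (S.sum (SemiGraph.ofGraph (⊤ : SimpleGraph (Fin (k + 1))))).maxDegree = k := by
    rw [SemiGraph.maxDegree_sum, SemiGraph.maxDegree_ofGraph_top, max_eq_right hS]
  have hrun : A.run (I.sum J hc) = LocalInput.labeling (I.sum J hc) fun x =>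
      A.out (Nat.card V + (k + 1)) k
        ((I.sum J hc).view (A.rounds (Nat.card V + (k + 1)) k) x) := by
    funext x
    rw [LocalAlgorithm.run, hcard, hdeg]
    rfl
  rw [hrun] at h
  refine ⟨fun v => ?_, fun e => ?_⟩
  · have := h.1 (.inl v)
    rwa [SemiGraph.nodeLabels_labeling, SemiGraph.sum_degree_inl, LocalInput.view_sum_inl,
      ← SemiGraph.nodeLabels_labeling I (fun v => A.out (Nat.card V + (k + 1)) k
      (I.view (A.rounds (Nat.card V + (k + 1)) k) v))] at this
  · have := h.2 (.inl e)
    rw [SemiGraph.edgeLabels_sum_inl, SemiGraph.sum_rank_inl] at this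
    simp only [LocalInput.labeling, LocalInput.view_sum_inl] at this
    exact this

/-- The radius adds up `3 l` to recognize the compressed nodes, 1 for the ranks and links of their
semi-graph, the rounds of `A`, 1 for the labels of neighbours, and `2 l` to see a raked component.
-/
theorem exists_tree_rule (hc : 1 ≤ c) (hlist : P.EdgeListAlwaysSolvable) (A : LocalAlgorithm L)
    (hA : ∀ (V E : Type) [Finite V] [Finite E] (S : SemiGraph V E) (I : LocalInput S c),
      P.IsSolution S (A.run I)) (n : ℕ) {k : ℕ} (hk : 36 ≤ k) :
    ∃ out : LocalView → ℕ → L, ∀ D : TreeInput n c, P.IsSolution (SemiGraph.ofGraph D.G)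
      (LocalInput.labeling D.I fun v => out (D.I.view
        (3 * (Nat.log k (n ^ 2) + 1) + 1 + A.rounds (n + (k + 1)) k + 1 +
          2 * (Nat.log k (n ^ 2) + 1)) v)) := by
  have : Nonempty L := ⟨A.out 0 0 ⟨0, ∅, ∅, ∅⟩ 0⟩
  set l := Nat.log k (n ^ 2) + 1
  set R := A.rounds (n + (k + 1)) k
  have hU : TreeInput.IsLocal (3 * l) fun (D : TreeInput n c) v => v ∈ D.G.compressed k l :=
    TreeInput.IsLocal.compressed k l
  obtain ⟨F', hF', hsol⟩ := P.exists_isLocal_completion (j := 2 * l)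
    (hU.mono (T' := 3 * l + 1 + R) (by omega))
    ((hU.view_restrictNodes R).comp fun w => A.out (n + (k + 1)) k w) (fun D v u hvu => by
      have hl : D.G.peel k l = ∅ := by
        have := D.isTree.isAcyclic.peel_eq_empty D.G k hk
        rwa [D.card_eq] at this
      obtain ⟨p, hp⟩ := SimpleGraph.exists_walk_length_le_of_peel_eq_empty k hl hvu
      exact (SimpleGraph.edist_le p).trans (by exact_mod_cast hp)) (fun D => by
      refine hlist.exists_completion P D.I (D.G.compressed k l) _ ?_
      have := P.isSolution_restrictNodes hc A hA (SemiGraph.maxDegree_restrictNodes_ofGraph_le D.G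
        fun v hv => D.G.degreeIn_compressed_le k l hv) (D.I.restrictNodes (D.G.compressed k l))
      rw [D.card_eq] at this
      exact this)
  obtain ⟨out, hout⟩ := hF'.exists_out
  refine ⟨out, fun D => ?_⟩
  simp only [hout]
  exact hsol D

end NodeEdgeProblem

/-! ### Iterated logarithm and choice of the degree threshold -/

theorem exists_iterate_logb_le_one (m : ℕ) : ∀ x : ℝ, x ≤ m → ∃ k, (Real.logb 2)^[k] x ≤ 1 := by
  induction m with
  | zero => exact fun x hx => ⟨0, by simpa using hx.trans (by norm_num)⟩
  | succ m ih =>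
    intro x hx
    rcases le_or_gt x 1 with h1 | h1
    · exact ⟨0, h1⟩
    · have hle : x ≤ (2 : ℝ) ^ (m : ℝ) := by
        rw [Real.rpow_natCast]
        refine hx.trans ?_
        exact_mod_cast (Nat.lt_two_pow_self (n := m))
      obtain ⟨k, hk⟩ := ih _ ((Real.logb_le_iff_le_rpow (by norm_num) (by linarith)).mpr hle)
      exact ⟨k + 1, hk⟩

theorem iterate_logStar_le_one (x : ℝ) : (Real.logb 2)^[logStar x] x ≤ 1 := by
  obtain ⟨m, hm⟩ := exists_nat_ge x
  exact Nat.sInf_mem (s := {k : ℕ | (Real.logb 2)^[k] x ≤ 1}) (exists_iterate_logb_le_one m x hm)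

theorem logStar_le {x : ℝ} {k : ℕ} (h : (Real.logb 2)^[k] x ≤ 1) : logStar x ≤ k := Nat.sInf_le h

theorem logStar_le_of_iterate (k : ℕ) :
    ∀ {x y : ℝ}, x ≤ y → (Real.logb 2)^[k] y ≤ 1 → logStar x ≤ k := by
  -- The iteration for `x` may have to stop earlier, because `Real.logb 2` is monotone only on
  -- positive arguments.
  suffices h : ∀ {x y : ℝ}, x ≤ y → (Real.logb 2)^[k] y ≤ 1 →
      ∃ k' ≤ k, (Real.logb 2)^[k'] x ≤ 1 by
    intro x y hxy hy
    obtain ⟨k', hk', hx⟩ := h hxy hy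
    exact (logStar_le hx).trans hk'
  induction k with
  | zero => exact fun hxy hy => ⟨0, le_rfl, hxy.trans hy⟩
  | succ k ih =>
    intro x y hxy hy
    rcases le_or_gt x 1 with h1 | h1
    · exact ⟨0, Nat.zero_le _, h1⟩
    · obtain ⟨k', hk', hx⟩ := ih (Real.logb_le_logb_of_le (by norm_num) (by linarith) hxy) hy
      exact ⟨k' + 1, by omega, hx⟩

theorem logStar_mono : Monotone logStar :=
  fun _ y h => logStar_le_of_iterate _ h (iterate_logStar_le_one y)

theorem logStar_le_add_one_of_le_two_pow {a b : ℕ} (h : a ≤ 2 ^ b) :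
    logStar a ≤ logStar b + 1 := by
  refine (logStar_mono (show (a : ℝ) ≤ (2 : ℝ) ^ (b : ℝ) by
    rw [Real.rpow_natCast]; exact_mod_cast h)).trans (logStar_le ?_)
  rw [Function.iterate_succ_apply, Real.logb_rpow (by norm_num) (by norm_num)]
  exact iterate_logStar_le_one b

theorem one_le_logStar {n : ℕ} (hn : 2 ≤ n) : 1 ≤ logStar n := by
  by_contra h
  have h0 : logStar n = 0 := by omega
  have := iterate_logStar_le_one n
  rw [h0, Function.iterate_zero, id] at this
  have : n ≤ 1 := by exact_mod_cast this
  omega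

/-- Three exponentials suffice: `m ≤ 2 ^ (n + 4)`, `n + 4 ≤ 2 ^ (n + 1)` and `n + 1 ≤ 2 ^ n`. -/
theorem logStar_le_add_three {n m : ℕ} (hn : 2 ≤ n) (hm : m ≤ 2 * n + 37) :
    logStar m ≤ logStar n + 3 := by
  have h1 : n + 1 ≤ 2 ^ n := Nat.lt_two_pow_self
  have h2 : n + 4 ≤ 2 ^ (n + 1) := by rw [pow_succ]; omega
  have h4 : 4 ≤ 2 ^ n := Nat.pow_le_pow_right (n := 2) (by norm_num) hn
  have h3 : m ≤ 2 ^ (n + 4) := by rw [pow_add]; omega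
  have e1 := logStar_le_add_one_of_le_two_pow h1
  have e2 := logStar_le_add_one_of_le_two_pow h2
  have e3 := logStar_le_add_one_of_le_two_pow h3
  omega

/-- The degree bound of the tree decomposition. -/
noncomputable def degreeBound (x : ℝ≥0) (n : ℕ) : ℕ := max 36 (min ⌊x⌋₊ n)

/-- If `n ≤ k`, the logarithm is at most 2. Otherwise the cap at `n` is inactive, so `x < k + 1 ≤ k
^ 2`, hence `n = x ^ y ≤ k ^ (2 y)` and `n ^ 2 ≤ k ^ (4 y)`. -/
theorem log_degreeBound_le {x y : ℝ≥0} {n : ℕ} (hn : 1 ≤ n) (h : x ^ (y : ℝ) = n) :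
    (Nat.log (degreeBound x n) (n ^ 2) : ℝ) ≤ 4 * y + 2 := by
  set k := degreeBound x n with hk
  have hk36 : 36 ≤ k := le_max_left _ _
  have hy : (0 : ℝ) ≤ y := y.2
  rcases le_or_gt n k with hnk | hnk
  · have : Nat.log k (n ^ 2) ≤ 2 :=
      (Nat.log_mono_right (Nat.pow_le_pow_left hnk 2)).trans (Nat.log_pow (by omega) 2).le
    have : (Nat.log k (n ^ 2) : ℝ) ≤ 2 := by exact_mod_cast this
    linarith
  · have hfl : ⌊x⌋₊ ≤ k := by
      have : min ⌊x⌋₊ n ≤ k := le_max_right _ _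
      omega
    have hkR : (36 : ℝ) ≤ k := by exact_mod_cast hk36
    have hx : (x : ℝ) ≤ (k : ℝ) ^ 2 := by
      have h1 : (x : ℝ) < ⌊x⌋₊ + 1 := by exact_mod_cast Nat.lt_floor_add_one x
      have h2 : (⌊x⌋₊ : ℝ) ≤ k := by exact_mod_cast hfl
      nlinarith
    have hnR : (n : ℝ) ≤ (k : ℝ) ^ (2 * (y : ℝ)) := by
      have : (n : ℝ) = (x : ℝ) ^ (y : ℝ) := by
        rw [← NNReal.coe_rpow, h]
        simp
      rw [this, Real.rpow_mul (by linarith)]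
      refine Real.rpow_le_rpow x.2 ?_ hy
      rw [Real.rpow_two]
      exact hx
    have hle : (k : ℝ) ^ (Nat.log k (n ^ 2) : ℝ) ≤ (k : ℝ) ^ (4 * (y : ℝ)) := by
      calc (k : ℝ) ^ (Nat.log k (n ^ 2) : ℝ) ≤ (n : ℝ) ^ 2 := by
            rw [Real.rpow_natCast]
            exact_mod_cast Nat.pow_log_le_self k (pow_ne_zero 2 (by omega))
        _ ≤ ((k : ℝ) ^ (2 * (y : ℝ))) ^ 2 := by gcongr
        _ = (k : ℝ) ^ (4 * (y : ℝ)) := by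
            rw [← Real.rpow_mul_natCast (by linarith)]
            congr 1
            push_cast
            ring
    have := (Real.rpow_le_rpow_left_iff (by linarith)).mp hle
    linarith

/-! ### Running time and correctness of the algorithm on trees -/

theorem mainTheorem3 {L : Type*} (P : NodeEdgeProblem L) (c : ℕ) (hc : 1 ≤ c)
    (f : ℝ≥0 → ℝ≥0) (f_continuous : Continuous f) (f_monotone : Monotone f) (f_zero : f 0 = 0)
    (f_nonzero : ∃ x, 0 < x ∧ 0 < f x)
    (hA : P.SolvableOnSemiGraphs c (fun n Δ => (f Δ : ℝ) + logStar n))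
    (hlist : P.EdgeListAlwaysSolvable)
    (g : ℕ → ℝ≥0) (hg : ∀ n : ℕ, 1 ≤ n → g n ^ (f (g n) : ℝ) = n) :
    P.SolvableOnTrees c (fun n => (f (g n) : ℝ) + logStar n) := by
  obtain ⟨A, ⟨C, hC⟩, hA⟩ := hA
  let k : ℕ → ℕ := fun n => degreeBound (g n) n
  have hk : ∀ n, 36 ≤ k n := fun n => le_max_left _ _
  have hrule := fun n => P.exists_tree_rule hc hlist A hA n (hk n)
  choose out hout using hrule
  -- For `n = 1` the required bound can vanish, so no round may be used there.
  refine ⟨⟨fun n _ => if n ≤ 1 then 0 else 3 * (Nat.log (k n) (n ^ 2) + 1) + 1 +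
    A.rounds (n + (k n + 1)) (k n) + 1 + 2 * (Nat.log (k n) (n ^ 2) + 1), fun n _ => out n⟩,
    -- The rounds outside `A` number `5 log + 7 ≤ 5 (4 f + 2) + 7 = 20 f + 17`, and 37 is the sum of
    -- these coefficients. In the cost of `A`, the 4 covers `log* n + 3`.
    ⟨37 + |C| * (4 + f 36), fun n Δ => ?_⟩, fun V _ G hG I => ?_⟩
  · have hf0 : (0 : ℝ) ≤ f (g n) := (f (g n)).2
    have hf36 : (0 : ℝ) ≤ f 36 := (f 36).2
    have hC0 := abs_nonneg C
    by_cases hn : n ≤ 1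
    · simp only [hn, if_true, Nat.cast_zero]
      positivity
    · have hn2 : 2 ≤ n := by omega
      simp only [hn, if_false]
      -- For `n ≥ 2` the term `log* n` absorbs all additive constants.
      have hs : (1 : ℝ) ≤ logStar n := by exact_mod_cast one_le_logStar hn2
      have hlog : (Nat.log (k n) (n ^ 2) : ℝ) ≤ 4 * f (g n) + 2 :=
        log_degreeBound_le (by omega) (hg n (by omega))
      have hfk : (f (k n) : ℝ) ≤ f 36 + f (g n) := by
        have h1 : ((k n : ℕ) : ℝ≥0) ≤ max 36 (g n) := by
          rw [show k n = max 36 (min ⌊g n⌋₊ n) from rfl, Nat.cast_max]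
          refine max_le_max (by simp) ?_
          exact (Nat.cast_le.mpr (min_le_left _ _)).trans (Nat.floor_le zero_le)
        have h2 : f (k n) ≤ f 36 + f (g n) := by
          refine (f_monotone h1).trans ?_
          rw [f_monotone.map_max]
          exact max_le le_self_add le_add_self
        exact_mod_cast h2
      -- Capping `k` by `n` up to the constant 36 bounds the padded size by `2 n + 37`.
      have hstar : (logStar ((n + (k n + 1) : ℕ) : ℝ) : ℝ) ≤ logStar n + 3 := by
        have : k n ≤ 36 + n := max_le (by omega) ((min_le_right _ _).trans (by omega))
        exact_mod_cast logStar_le_add_three (m := n + (k n + 1)) hn2 (by omega)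
      have hR : (A.rounds (n + (k n + 1)) (k n) : ℝ) ≤
          |C| * (4 + f 36) * (f (g n) + logStar n) := by
        refine (hC _ _).trans ?_
        have hpos : (0 : ℝ) ≤ f (k n) := (f (k n)).2
        have hspos : (0 : ℝ) ≤ logStar ((n + (k n + 1) : ℕ) : ℝ) := Nat.cast_nonneg _
        calc _ ≤ |C| * ((f (k n) : ℝ) + logStar ((n + (k n + 1) : ℕ) : ℝ)) := by
              gcongr
              exact le_abs_self C
          _ ≤ |C| * ((4 + f 36) * (f (g n) + logStar n)) := by
              gcongr
              nlinarith
          _ = _ := by ring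
      push_cast at hR ⊢
      nlinarith
  · by_cases hn : Nat.card V ≤ 1
    -- There are no half-edges, so all labelings coincide with the valid output of `A`.
    · have hsub : Subsingleton V := Finite.card_le_one_iff_subsingleton.mp hn
      have hE : IsEmpty (SemiGraph.ofGraph G).HalfEdge := by
        refine ⟨fun x => ?_⟩
        obtain ⟨⟨v, ⟨e, he⟩⟩, hx⟩ := x
        induction e using Sym2.ind with
        | _ a b => exact G.ne_of_adj he (Subsingleton.elim a b)
      rw [Subsingleton.elim (LocalAlgorithm.run _ I) (A.run I)]
      exact hA _ _ _ I
    · have h := hout (Nat.card V) ⟨V, inferInstance, rfl, G, hG, I⟩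
      convert h using 1
      funext x
      simp only [LocalAlgorithm.run, LocalInput.labeling, if_neg hn]
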